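/- \textbf{Notation.} Let $P_k(\mathbb R^d)$ be the Borel probability measures on $\mathbb R^d$ with finite $k$-th moment. For $\mu,\nu\in P_1(\mathbb R^d)$ write $\mu\le_{\rm cx}\nu$ if $\int\varphi\,d\mu\le\int\varphi\,d\nu$ for every convex $\varphi:\mathbb R^d\to\mathbb R$ for which both integrals exist in the extended sense. Put $$\mathrm P^{\rm cx}_{k,\le\nu}=\{\eta\in P_k(\mathbb R^d):\eta\le_{\rm cx}\nu\},\qquad \mathrm P^{\rm cx}_{k,\mu\le}=\{\xi\in P_k(\mathbb R^d):\mu\le_{\rm cx}\xi\}.$$ Let $\mathcal T_2(\mu,\nu)=\inf_{\pi\in\Pi(\mu,\nu)}\int|x-y|^2\,d\pi(x,y)$, where $\Pi(\mu,\nu)$ is the set of couplings of $\mu$ and $\nu$, and $$\mathcal T_2(\mu,\mathrm P^{\rm cx}_{k,\le\nu})=\inf_{\eta\in\mathrm P^{\rm cx}_{k,\le\nu}}\mathcal T_2(\mu,\eta),\qquad \mathcal T_2(\mathrm P^{\rm cx}_{k,\mu\le},\nu)=\inf_{\xi\in\mathrm P^{\rm cx}_{k,\mu\le}}\mathcal T_2(\xi,\nu).$$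 Let $\mathcal A_{\rm cx}$ be the class of proper, convex, lower semicontinuous functions $\varphi:\mathbb R^d\to\mathbb R\cup\{+\infty\}$, and let $C_{b,k}$ (respectively $S_{b,k}$) be the class of continuous (respectively Borel measurable) functions $u:\mathbb R^d\to\mathbb R$ with $u/(1+|x|^k)$ bounded. For $\varphi\in\mathcal A_{\rm cx}$ put $$Q_2(\varphi)(x)=\inf_{y\in\mathbb R^d}\{\varphi(y)+|x-y|^2\},\qquad Q_{\bar 2}(\varphi)(y)=\sup_{x\in\mathbb R^d}\{\varphi(x)-|x-y|^2\}.$$ \textbf{Theorem.} Let $\mu,\nu\in P_2(\mathbb R^d)$. All integrals below exist in the extended sense (values in $[-\infty,\infty]$), the integrals $\int\varphi\,d\nu$ in (i) and $\int\varphi\,d\mu$ in (ii) being finite, and the following holds. (i) For $k=1,2$, $$\mathcal T_2(\mu,\mathrm P^{\rm cx}_{1,\le\nu})=\mathcal T_2(\mu,\mathrm P^{\rm cx}_{2,\le\nu})=\sup_{\varphi\in\mathcal A_{\rm cx}\cap C_{b,k}}\Big\{\int Q_2(\varphi)\,d\mu-\int\varphi\,d\nu\Big\}=\sup_{\varphi\in\mathcal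 A_{\rm cx}\cap L^1(\nu)}\Big\{\int Q_2(\varphi)\,d\mu-\int\varphi\,d\nu\Big\}.$$ (ii) For $k=1,2$, $$\mathcal T_2(\mathrm P^{\rm cx}_{1,\mu\le},\nu)=\mathcal T_2(\mathrm P^{\rm cx}_{2,\mu\le},\nu)=\sup_{\varphi\in\mathcal A_{\rm cx}\cap C_{b,k}}\Big\{\int\varphi\,d\mu-\int Q_{\bar 2}(\varphi)\,d\nu\Big\}.$$ In particular all these values are independent of $k$. Moreover, in both (i) and (ii) the class $\mathcal A_{\rm cx}\cap C_{b,k}$ may be replaced by $\mathcal A_{\rm cx}\cap S_{b,k}$ without changing the supremum. -/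

import Mathlib

open MeasureTheory
open scoped ENNReal

noncomputable section

namespace ConvexOrderProjection

/-- The Euclidean space `ℝ^d`. -/
abbrev Rd (d : ℕ) : Type := EuclideanSpace ℝ (Fin d)

/-! ### Integrals in the extended sense -/

/-- `∫ f⁺ dμ`. -/
def posInt {d : ℕ} (f : Rd d → EReal) (μ : Measure (Rd d)) : ℝ≥0∞ :=
  ∫⁻ x, (f x).toENNReal ∂μ

/-- `∫ f⁻ dμ`. -/
def negInt {d : ℕ} (f : Rd d → EReal) (μ : Measure (Rd d)) : ℝ≥0∞ :=
  ∫⁻ x, (-(f x)).toENNReal ∂μ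

/-- The integral `∫ f dμ` exists in the extended sense: `f` is measurable, and at least one of
`∫ f⁺ dμ` and `∫ f⁻ dμ` is finite. -/
def HasExtInt {d : ℕ} (f : Rd d → EReal) (μ : Measure (Rd d)) : Prop :=
  AEMeasurable f μ ∧ (posInt f μ ≠ ⊤ ∨ negInt f μ ≠ ⊤)

/-- The extended integral `∫ f dμ = ∫ f⁺ dμ - ∫ f⁻ dμ` in `[-∞, ∞]`; it is meaningful
when `HasExtInt f μ` holds. -/
def extInt {d : ℕ} (f : Rd d → EReal) (μ : Measure (Rd d)) : EReal :=
  (posInt f μ : EReal) - (negInt f μ : EReal)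

/-- Extended-real valued functions in `L¹(μ)` (such a function is finite `μ`-a.e.). -/
def L1 {d : ℕ} (μ : Measure (Rd d)) : Set (Rd d → EReal) :=
  {f | AEMeasurable f μ ∧ posInt f μ ≠ ⊤ ∧ negInt f μ ≠ ⊤}

/-! ### Classes of functions -/

/-- `C_{b,k}`: the (real-valued) continuous functions `u` with `u / (1 + |x|^k)` bounded. -/
def Cb (d k : ℕ) : Set (Rd d → EReal) :=
  {φ | ∃ u : Rd d → ℝ, Continuous u ∧ (∃ C : ℝ, ∀ x, |u x| / (1 + ‖x‖ ^ k) ≤ C) ∧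
    φ = fun x => (u x : EReal)}

/-- `S_{b,k}`: the (real-valued) measurable functions `u` with `u / (1 + |x|^k)` bounded. -/
def Sb (d k : ℕ) : Set (Rd d → EReal) :=
  {φ | ∃ u : Rd d → ℝ, Measurable u ∧ (∃ C : ℝ, ∀ x, |u x| / (1 + ‖x‖ ^ k) ≤ C) ∧
    φ = fun x => (u x : EReal)}

/-- The class of proper, convex, lower semicontinuous functions `φ : ℝ^d → (-∞, ∞]`. -/
def Acx (d : ℕ) : Set (Rd d → EReal) :=
  {φ | (∀ x, φ x ≠ ⊥) ∧ (∃ x, φ x ≠ ⊤) ∧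
    (∀ x y : Rd d, ∀ a b : ℝ, 0 < a → 0 < b → a + b = 1 →
      φ (a • x + b • y) ≤ (a : EReal) * φ x + (b : EReal) * φ y) ∧
    LowerSemicontinuous φ}

/-! ### Measures with finite moments, convex order and its cones -/

/-- `P_k(ℝ^d)`: the Borel probability measures with finite `k`-th moment. -/
def P (d k : ℕ) : Set (Measure (Rd d)) :=
  {μ | IsProbabilityMeasure μ ∧ ∫⁻ x, ‖x‖ₑ ^ k ∂μ < ⊤}

/-- Convex order: `∫ φ dμ ≤ ∫ φ dν` for every real-valued convex function `φ` on `ℝ^d` for which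
both integrals exist in the extended sense. -/
def ConvexOrder {d : ℕ} (μ ν : Measure (Rd d)) : Prop :=
  ∀ φ : Rd d → ℝ, ConvexOn ℝ Set.univ φ →
    HasExtInt (fun x => (φ x : EReal)) μ → HasExtInt (fun x => (φ x : EReal)) ν →
    extInt (fun x => (φ x : EReal)) μ ≤ extInt (fun x => (φ x : EReal)) ν

/-- The backward cone: `η ∈ P_k` with `η ≤ ν` in convex order. -/
def backwardCone {d : ℕ} (k : ℕ) (ν : Measure (Rd d)) : Set (Measure (Rd d)) :=
  {η | η ∈ P d k ∧ ConvexOrder η ν}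

/-- The forward cone: `ξ ∈ P_k` with `μ ≤ ξ` in convex order. -/
def forwardCone {d : ℕ} (k : ℕ) (μ : Measure (Rd d)) : Set (Measure (Rd d)) :=
  {ξ | ξ ∈ P d k ∧ ConvexOrder μ ξ}

/-! ### Transport costs -/

/-- `Π(μ, ν)`: the probability couplings of `μ` and `ν`. -/
def couplings {d : ℕ} (μ ν : Measure (Rd d)) : Set (Measure (Rd d × Rd d)) :=
  {π | IsProbabilityMeasure π ∧ π.map Prod.fst = μ ∧ π.map Prod.snd = ν}

/-- The quadratic transport cost `T₂(μ, ν) = inf_π ∫ |x - y|² dπ`. -/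
def T2 {d : ℕ} (μ ν : Measure (Rd d)) : ℝ≥0∞ :=
  ⨅ π ∈ couplings μ ν, ∫⁻ p, ‖p.1 - p.2‖ₑ ^ 2 ∂π

/-- The cost of the backward projection of `μ` onto the backward cone with vertex `ν`. -/
def T2Backward {d : ℕ} (k : ℕ) (μ ν : Measure (Rd d)) : ℝ≥0∞ :=
  ⨅ η ∈ backwardCone k ν, T2 μ η

/-- The cost of the forward projection of `ν` onto the forward cone with vertex `μ`. -/
def T2Forward {d : ℕ} (k : ℕ) (μ ν : Measure (Rd d)) : ℝ≥0∞ :=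
  ⨅ ξ ∈ forwardCone k μ, T2 ξ ν

/-! ### Dual functionals -/

/-- `Q₂(φ)(x) = inf_y {φ(y) + |x - y|²}`. -/
def Q2 {d : ℕ} (φ : Rd d → EReal) (x : Rd d) : EReal :=
  ⨅ y : Rd d, φ y + ((‖x - y‖ ^ 2 : ℝ) : EReal)

/-- `Q_{2̄}(φ)(y) = sup_x {φ(x) - |x - y|²}`. -/
def Q2bar {d : ℕ} (φ : Rd d → EReal) (y : Rd d) : EReal :=
  ⨆ x : Rd d, φ x - ((‖x - y‖ ^ 2 : ℝ) : EReal)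

/-- `∫ Q₂(φ) dμ - ∫ φ dν`. -/
def backwardDual {d : ℕ} (μ ν : Measure (Rd d)) (φ : Rd d → EReal) : EReal :=
  extInt (Q2 φ) μ - extInt φ ν

/-- `∫ φ dμ - ∫ Q_{2̄}(φ) dν`. -/
def forwardDual {d : ℕ} (μ ν : Measure (Rd d)) (φ : Rd d → EReal) : EReal :=
  extInt φ μ - extInt (Q2bar φ) ν

end ConvexOrderProjection

end

open ConvexOrderProjection

open Filter Topology Set

/-! Weak duality comes from integrating `Q2 φ x ≤ φ y + |x - y|²`, or `φ x ≤ Q2bar φ y + |x - y|²`,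
against a coupling and then using the convex order. The rest shows that both projection costs are at
most S, the supremum of `backwardDual` over Lipschitz convex functions.

Let S = w be finite. On L²(μ; ℝ^d) put F(φ, m) = ∫ φ(m) dμ + ‖id - m‖² - ∫ φ dν. It is affine in φ,
and its minimum over m is the dual value of φ, attained at the proximal map of φ with quadratic
growth around it. This growth makes the minimizers along a maximizing sequence Cauchy, so
completeness alone yields one m with F(φ, m) ≤ w for all φ (`exists_forall_le_of_quadratic_growth`).
Taking φ = 0 gives ‖id - m‖² ≤ w; scaling φ up gives ∫ φ(m) dμ ≤ ∫ φ dν. Hence the law of m lies in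
the backward cone of ν and costs at most w.

For the forward problem, suppose X has law μ and Y has law ν with E[Y | X] = m(X). Then Y + X - m(X)
has conditional mean X, so its law dominates μ by Jensen, and its squared distance to Y is |X -
m(X)|². An approximate version of this coupling suffices: m is averaged over the cells of a finite
partition, and Hahn-Banach separation supplies conditional densities with almost the right
barycenters (`exists_densities_of_lipConvex_le`).

Finally `Q2bar (Q2 φ) ≤ φ` turns each backward potential into a forward one that is at least as
good, so all the inequalities close up and both costs equal S. -/

/-- The convex cone of Lipschitz convex functions on `ℝ^d`. -/
def LipConvex (d : ℕ) : Set (Rd d → ℝ) :=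
  {φ | ConvexOn ℝ univ φ ∧ ∃ L : ℝ, 0 ≤ L ∧ ∀ x y, φ x - φ y ≤ L * ‖x - y‖}

/-! ### Affine minorants and Lipschitz regularization of convex functions -/

section Minorant

variable {d : ℕ} {φ : Rd d → EReal}

lemma Acx.coe_toReal (hφ : φ ∈ Acx d) {x : Rd d} (hx : φ x ≠ ⊤) : ((φ x).toReal : EReal) = φ x :=
  EReal.coe_toReal hx (hφ.1 x)

lemma Acx.convex_combination (hφ : φ ∈ Acx d) {x y : Rd d} {s t : ℝ} (hx : φ x ≤ s) (hy : φ y ≤ t)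
    {a b : ℝ} (ha : 0 < a) (hb : 0 < b) (hab : a + b = 1) :
    φ (a • x + b • y) ≤ ((a * s + b * t : ℝ) : EReal) := by
  refine (hφ.2.2.1 x y a b ha hb hab).trans ?_
  push_cast
  exact add_le_add (mul_le_mul_of_nonneg_left hx (by exact_mod_cast ha.le))
    (mul_le_mul_of_nonneg_left hy (by exact_mod_cast hb.le))

lemma Acx.convex_epigraph (hφ : φ ∈ Acx d) :
    Convex ℝ {p : Rd d × ℝ | φ p.1 ≤ (p.2 : EReal)} := by
  rw [convex_iff_forall_pos]
  intro p hp q hq a b ha hb hab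
  simpa using (Acx.convex_combination hφ) hp hq ha hb hab

lemma Acx.isClosed_epigraph (hφ : φ ∈ Acx d) :
    IsClosed {p : Rd d × ℝ | φ p.1 ≤ (p.2 : EReal)} :=
  (lowerSemicontinuous_iff_isClosed_epigraph.1 hφ.2.2.2).preimage
    (continuous_id.prodMap continuous_coe_real_ereal)

/-- A proper convex lower semicontinuous function grows at most linearly towards `-∞`. -/
lemma Acx.exists_linear_lower_bound (hφ : φ ∈ Acx d) :
    ∃ C : ℝ, 0 ≤ C ∧ ∀ x, ((-(C * (1 + ‖x‖)) : ℝ) : EReal) ≤ φ x := by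
  obtain ⟨x₀, hx₀⟩ := hφ.2.1
  set t₀ := (φ x₀).toReal
  have ht₀ : (t₀ : EReal) = φ x₀ := (Acx.coe_toReal hφ) hx₀
  -- The separated point lies directly below the epigraph point (x₀, t₀), so the vertical
  -- coefficient `c` of the functional is positive.
  obtain ⟨f, u, hfu, hfe⟩ := geometric_hahn_banach_point_closed (Acx.convex_epigraph hφ)
    (Acx.isClosed_epigraph hφ) (x := (x₀, t₀ - 1)) (by
      simp only [mem_ofPred_eq, ← ht₀, EReal.coe_le_coe_iff]; linarith)
  have hdec : ∀ x : Rd d, ∀ t : ℝ, f (x, t) = f (x, 0) + t * f (0, 1) := by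
    intro x t
    have : ((x, t) : Rd d × ℝ) = (x, 0) + t • (0, 1) := by simp
    rw [this, map_add, map_smul, smul_eq_mul]
  set c := f (0, 1)
  have hc : 0 < c := by
    have h1 := hfe (x₀, t₀) ht₀.ge
    rw [hdec] at h1 hfu
    nlinarith
  have hb : ∀ x : Rd d, |f (x, 0)| ≤ ‖f‖ * ‖x‖ := fun x => by
    simpa using f.le_opNorm (x, (0 : ℝ))
  refine ⟨(|u| + ‖f‖) / c, by positivity, fun x => ?_⟩
  by_cases hx : φ x = ⊤
  · simp [hx]
  rw [← (Acx.coe_toReal hφ) hx, EReal.coe_le_coe_iff]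
  have h1 := hfe (x, (φ x).toReal) ((Acx.coe_toReal hφ) hx).ge
  rw [hdec] at h1
  have h2 := (abs_le.1 (hb x)).2
  rw [neg_le, div_mul_eq_mul_div, le_div_iff₀' hc] at *
  nlinarith [neg_abs_le u, abs_nonneg u, norm_nonneg f, norm_nonneg x,
    mul_nonneg (abs_nonneg u) (norm_nonneg x)]

/-- Proper convex lower semicontinuous functions are increasing limits of Lipschitz convex
functions. -/
lemma Acx.exists_lipConvex_approx (hφ : φ ∈ Acx d) :
    ∃ ψ : ℕ → Rd d → ℝ, (∀ n, ψ n ∈ LipConvex d) ∧ (∀ x, Monotone fun n => ψ n x) ∧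
      (∀ n x, (ψ n x : EReal) ≤ φ x) ∧
      ∀ x, Tendsto (fun n => (ψ n x : EReal)) atTop (𝓝 (φ x)) := by
  obtain ⟨C, hC, hlow⟩ := (Acx.exists_linear_lower_bound hφ)
  let D := {y : Rd d // φ y ≠ ⊤}
  obtain ⟨y₀, hy₀⟩ := hφ.2.1
  have : Nonempty D := ⟨⟨y₀, hy₀⟩⟩
  -- Infimal convolution with (C + n)‖·‖: the slope C compensates the linear decrease of φ and keeps
  -- the infimum finite, while the surplus n forces convergence.
  let g : ℕ → Rd d → D → ℝ := fun n x y => (φ y).toReal + (C + n) * ‖x - y‖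
  have hlow' : ∀ y : D, -(C * (1 + ‖(y : Rd d)‖)) ≤ (φ y).toReal := fun y => by
    rw [← EReal.coe_le_coe_iff, (Acx.coe_toReal hφ) y.2]; exact hlow y
  have hg : ∀ n x (y : D), -(C * (1 + ‖x‖)) + n * ‖x - (y : Rd d)‖ ≤ g n x y := fun n x y => by
    have h1 : ‖(y : Rd d)‖ ≤ ‖x‖ + ‖x - y‖ := by
      rw [norm_sub_rev]; exact norm_le_norm_add_norm_sub' _ _
    have := hlow' y
    simp only [g]; nlinarith
  have hbdd : ∀ n x, BddBelow (range (g n x)) := fun n x => ⟨-(C * (1 + ‖x‖)), by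
    rintro _ ⟨y, rfl⟩; exact le_trans (by simp; positivity) (hg n x y)⟩
  let ψ : ℕ → Rd d → ℝ := fun n x => ⨅ y : D, g n x y
  have hψle : ∀ n x y, ψ n x ≤ g n x y := fun n x y => ciInf_le (hbdd n x) y
  have hle : ∀ n x, (ψ n x : EReal) ≤ φ x := fun n x => by
    by_cases hx : φ x = ⊤
    · simp [hx]
    rw [← (Acx.coe_toReal hφ) hx, EReal.coe_le_coe_iff]
    simpa [g] using hψle n x ⟨x, hx⟩
  have hmono : ∀ x, Monotone fun n => ψ n x := fun x m n hmn =>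
    ciInf_mono (hbdd m x) fun y => by
      have : (m : ℝ) ≤ n := by exact_mod_cast hmn
      simp only [g]; gcongr
  refine ⟨ψ, fun n => ⟨⟨convex_univ, ?_⟩, C + n, by positivity, ?_⟩, hmono, hle, ?_⟩
  · intro x _ y _ a b ha hb hab
    rcases ha.eq_or_lt with rfl | ha
    · obtain rfl : b = 1 := by linarith
      simp
    rcases hb.eq_or_lt with rfl | hb
    · obtain rfl : a = 1 := by linarith
      simp
    refine le_of_forall_pos_le_add fun ε hε => ?_
    obtain ⟨u, hu⟩ := exists_lt_of_ciInf_lt (lt_add_of_pos_right (ψ n x) hε)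
    obtain ⟨w, hw⟩ := exists_lt_of_ciInf_lt (lt_add_of_pos_right (ψ n y) hε)
    have hcomb := (Acx.convex_combination hφ) ((Acx.coe_toReal hφ) u.2).ge ((Acx.coe_toReal hφ) w.2).ge ha hb hab
    have hz : φ (a • (u : Rd d) + b • (w : Rd d)) ≠ ⊤ := ne_top_of_le_ne_top (EReal.coe_ne_top _) hcomb
    rw [← (Acx.coe_toReal hφ) hz, EReal.coe_le_coe_iff] at hcomb
    have hn : ‖(a • x + b • y) - (a • (u : Rd d) + b • (w : Rd d))‖
        ≤ a * ‖x - u‖ + b * ‖y - w‖ := by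
      have : (a • x + b • y) - (a • (u : Rd d) + b • (w : Rd d)) = a • (x - u) + b • (y - w) := by
        module
      rw [this]
      refine (norm_add_le _ _).trans_eq ?_
      rw [norm_smul, norm_smul, Real.norm_of_nonneg ha.le, Real.norm_of_nonneg hb.le]
    have h3 := hψle n (a • x + b • y) ⟨_, hz⟩
    have hCn : 0 ≤ C + n := by positivity
    have h4 := mul_le_mul_of_nonneg_left hn hCn
    have hu' := mul_le_mul_of_nonneg_left hu.le ha.le
    have hw' := mul_le_mul_of_nonneg_left hw.le hb.le
    obtain rfl : b = 1 - a := by linarith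
    simp only [g, smul_eq_mul] at *
    linarith
  · intro x y
    rw [sub_le_iff_le_add, add_comm, ← sub_le_iff_le_add]
    refine le_ciInf fun w => ?_
    have h1 := hψle n x w
    have h2 : ‖x - w‖ ≤ ‖x - y‖ + ‖y - w‖ := norm_sub_le_norm_sub_add_norm_sub x y w
    have hCn : 0 ≤ C + n := by positivity
    simp only [g] at *
    nlinarith
  · intro x
    refine tendsto_order.2 ⟨fun t ht => ?_, fun t ht => .of_forall fun n => (hle n x).trans_lt ht⟩
    obtain ⟨s, hts, hs⟩ := EReal.lt_iff_exists_real_btwn.1 ht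
    -- Within δ of x, lower semicontinuity gives φ > s; farther away the surplus n‖x - y‖ ≥ nδ takes
    -- over.
    obtain ⟨δ, hδ, hball⟩ := Metric.eventually_nhds_iff.1 (hφ.2.2.2 x s hs)
    obtain ⟨N, hN⟩ := exists_nat_gt ((s + C * (1 + ‖x‖)) / δ)
    rw [div_lt_iff₀ hδ] at hN
    filter_upwards [eventually_ge_atTop N] with n hn
    refine hts.trans_le (EReal.coe_le_coe_iff.2 (le_ciInf fun y => ?_))
    by_cases hy : dist (y : Rd d) x < δ
    · have h1 : (s : EReal) < φ y := hball hy
      rw [← (Acx.coe_toReal hφ) y.2, EReal.coe_lt_coe_iff] at h1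
      have : 0 ≤ (C + n) * ‖x - y‖ := by positivity
      simp only [g]; linarith
    · rw [not_lt, dist_comm, dist_eq_norm] at hy
      have h1 := hg n x y
      have h2 : (N : ℝ) ≤ n := by exact_mod_cast hn
      have h3 : (N : ℝ) * δ ≤ n * ‖x - y‖ := by gcongr
      linarith

end Minorant

/-! ### Extended integrals -/

section ExtendedIntegral

variable {d : ℕ} {f g : Rd d → EReal} {μ η ν : Measure (Rd d)}

/-- Adding the finite negative parts to both sides removes all subtraction. The resulting inequality
in `ℝ≥0∞` allows infinite positive parts and is stable under limits. -/
lemma extInt_le_extInt_iff (hf : negInt f η ≠ ⊤) (hg : negInt g ν ≠ ⊤) :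
    extInt f η ≤ extInt g ν ↔ posInt f η + negInt g ν ≤ posInt g ν + negInt f η := by
  unfold extInt
  generalize posInt f η = a at *
  generalize negInt f η = b at *
  generalize posInt g ν = c at *
  generalize negInt g ν = e at *
  lift b to NNReal using hf
  lift e to NNReal using hg
  induction c with
  | top => simp
  | coe c =>
  induction a with
  | top =>
    simp only [EReal.coe_nnreal_eq_coe_real, ← EReal.coe_sub, ← ENNReal.coe_add,
      EReal.coe_ennreal_top, EReal.top_sub_coe, top_add, top_le_iff, EReal.coe_ne_top,
      ENNReal.coe_ne_top]
  | coe a =>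
    simp only [← ENNReal.coe_add, ENNReal.coe_le_coe]
    rw [← NNReal.coe_le_coe]
    push_cast
    simp only [EReal.coe_nnreal_eq_coe_real]
    rw [← EReal.coe_sub, ← EReal.coe_sub, EReal.coe_le_coe_iff]
    constructor <;> intro h <;> linarith

lemma posInt_congr (h : f =ᵐ[μ] g) : posInt f μ = posInt g μ :=
  lintegral_congr_ae (h.mono fun x hx => by simp only [hx])

lemma negInt_congr (h : f =ᵐ[μ] g) : negInt f μ = negInt g μ :=
  lintegral_congr_ae (h.mono fun x hx => by simp only [hx])

lemma posInt_mono (h : f ≤ᵐ[μ] g) : posInt f μ ≤ posInt g μ :=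
  lintegral_mono_ae (h.mono fun _ hx => EReal.toENNReal_le_toENNReal hx)

lemma negInt_anti (h : f ≤ᵐ[μ] g) : negInt g μ ≤ negInt f μ :=
  lintegral_mono_ae (h.mono fun _ hx => EReal.toENNReal_le_toENNReal (EReal.neg_le_neg_iff.2 hx))

lemma extInt_congr (h : f =ᵐ[μ] g) : extInt f μ = extInt g μ := by
  rw [extInt, extInt, posInt_congr h, negInt_congr h]

lemma posInt_coe (u : Rd d → ℝ) :
    posInt (fun x => (u x : EReal)) μ = ∫⁻ x, ENNReal.ofReal (u x) ∂μ := by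
  simp [posInt]

lemma negInt_coe (u : Rd d → ℝ) :
    negInt (fun x => (u x : EReal)) μ = ∫⁻ x, ENNReal.ofReal (-u x) ∂μ := by
  simp [negInt, ← EReal.coe_neg]

lemma lintegral_ofReal_ne_top {u : Rd d → ℝ} (hu : Integrable u μ) :
    ∫⁻ x, ENNReal.ofReal (u x) ∂μ ≠ ⊤ :=
  ((lintegral_mono fun _ => Real.ofReal_le_enorm _).trans_lt hu.2).ne

lemma coe_mem_L1 {u : Rd d → ℝ} (hu : Integrable u μ) : (fun x => (u x : EReal)) ∈ L1 μ :=
  ⟨hu.1.aemeasurable.coe_real_ereal, by rw [posInt_coe]; exact lintegral_ofReal_ne_top hu,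
    by rw [negInt_coe]; exact lintegral_ofReal_ne_top hu.neg⟩

lemma extInt_coe {u : Rd d → ℝ} (hu : Integrable u μ) :
    extInt (fun x => (u x : EReal)) μ = ((∫ x, u x ∂μ : ℝ) : EReal) := by
  have h1 := lintegral_ofReal_ne_top hu
  have h2 := lintegral_ofReal_ne_top hu.neg
  rw [integral_eq_lintegral_pos_part_sub_lintegral_neg_part hu, extInt, posInt_coe, negInt_coe,
    EReal.coe_sub, EReal.coe_ennreal_toReal, EReal.coe_ennreal_toReal]
  exacts [h2, h1]

lemma ae_eq_coe_toReal (hf : f ∈ L1 μ) : f =ᵐ[μ] fun x => ((f x).toReal : EReal) := by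
  obtain ⟨hm, hp, hn⟩ := hf
  filter_upwards [ae_lt_top' hm.ereal_toENNReal hp, ae_lt_top' hm.neg.ereal_toENNReal hn]
    with x h1 h2
  rw [EReal.coe_toReal]
  · intro h; simp [h] at h1
  · intro h; simp [h] at h2

lemma integrable_toReal (hf : f ∈ L1 μ) : Integrable (fun x => (f x).toReal) μ := by
  refine ⟨hf.1.ereal_toReal.aestronglyMeasurable, ?_⟩
  refine lt_of_le_of_lt (b := posInt f μ + negInt f μ) ?_
    (ENNReal.add_lt_top.2 ⟨hf.2.1.lt_top, hf.2.2.lt_top⟩)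
  rw [posInt_congr (ae_eq_coe_toReal hf), negInt_congr (ae_eq_coe_toReal hf), posInt_coe,
    negInt_coe, ← lintegral_add_left' hf.1.ereal_toReal.ennreal_ofReal]
  refine lintegral_mono fun x => ?_
  rw [← ofReal_norm, Real.norm_eq_abs]
  rcases abs_choice (f x).toReal with h | h <;> rw [h] <;> simp

lemma extInt_of_mem_L1 (hf : f ∈ L1 μ) : extInt f μ = ((∫ x, (f x).toReal ∂μ : ℝ) : EReal) := by
  rw [extInt_congr (ae_eq_coe_toReal hf), extInt_coe (integrable_toReal hf)]

end ExtendedIntegral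

/-! ### Moments and convex order tested on Lipschitz functions -/

section Moments

variable {d : ℕ} {μ η ν : Measure (Rd d)}

lemma integrable_norm_of_mem_P_one (hμ : μ ∈ P d 1) : Integrable (fun x => ‖x‖) μ := by
  have := hμ.1
  exact ⟨continuous_norm.aestronglyMeasurable, by simpa [HasFiniteIntegral] using hμ.2⟩

lemma memLp_two_of_mem_P_two (hμ : μ ∈ P d 2) : MemLp (fun x : Rd d => x) 2 μ :=
  ⟨continuous_id.aestronglyMeasurable, by
    rw [eLpNorm_lt_top_iff_lintegral_rpow_enorm_lt_top (by simp) (by simp)]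
    simpa using hμ.2⟩

lemma mem_P_two_of_memLp [IsProbabilityMeasure μ] (hμ : MemLp (fun x : Rd d => x) 2 μ) :
    μ ∈ P d 2 := by
  refine ⟨inferInstance, ?_⟩
  have := (eLpNorm_lt_top_iff_lintegral_rpow_enorm_lt_top (by simp) (by simp)).1 hμ.2
  simpa using this

lemma P_two_subset_P_one : P d 2 ⊆ P d 1 := fun μ hμ => by
  have := hμ.1
  exact ⟨this, by simpa [HasFiniteIntegral] using
    ((memLp_two_of_mem_P_two hμ).integrable one_le_two).2⟩

lemma LipConvex.continuous {φ : Rd d → ℝ} (hφ : φ ∈ LipConvex d) : Continuous φ := by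
  obtain ⟨-, L, hL, h⟩ := hφ
  refine (LipschitzWith.of_dist_le_mul (K := ⟨L, hL⟩) fun x y => ?_).continuous
  rw [Real.dist_eq, dist_eq_norm]
  exact abs_sub_le_iff.2 ⟨h x y, norm_sub_rev x y ▸ h y x⟩

lemma LipConvex.integrable_comp {Ω : Type*} [MeasurableSpace Ω] {ℙ : Measure Ω}
    [IsFiniteMeasure ℙ] {φ : Rd d → ℝ} (hφ : φ ∈ LipConvex d) {m : Ω → Rd d}
    (hm : Integrable m ℙ) : Integrable (fun ω => φ (m ω)) ℙ := by
  obtain ⟨L, hL, h⟩ := hφ.2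
  refine Integrable.mono' ((integrable_const |φ 0|).add (hm.norm.const_mul L))
    ((LipConvex.continuous hφ).comp_aestronglyMeasurable hm.1) (.of_forall fun ω => ?_)
  have h1 := h (m ω) 0
  have h2 := h 0 (m ω)
  rw [sub_zero] at h1
  rw [zero_sub, norm_neg] at h2
  simp only [Pi.add_apply, Real.norm_eq_abs]
  refine abs_le.2 ⟨?_, ?_⟩ <;> linarith [neg_abs_le (φ 0), le_abs_self (φ 0)]

lemma LipConvex.integrable {φ : Rd d → ℝ} (hφ : φ ∈ LipConvex d) (hμ : μ ∈ P d 1) :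
    Integrable φ μ := by
  have := hμ.1
  exact LipConvex.integrable_comp hφ (m := fun x => x)
    ((integrable_norm_iff continuous_id.aestronglyMeasurable).1 (integrable_norm_of_mem_P_one hμ))

lemma Acx.measurable {φ : Rd d → EReal} (hφ : φ ∈ Acx d) : Measurable φ :=
  hφ.2.2.2.measurable

lemma Acx.negInt_ne_top {φ : Rd d → EReal} (hφ : φ ∈ Acx d) (hμ : μ ∈ P d 1) :
    negInt φ μ ≠ ⊤ := by
  have := hμ.1
  obtain ⟨C, hC, h⟩ := Acx.exists_linear_lower_bound hφ
  have hi : Integrable (fun x => C * (1 + ‖x‖)) μ :=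
    ((integrable_const 1).add (integrable_norm_of_mem_P_one hμ)).const_mul C
  have := (coe_mem_L1 hi.neg).2.2
  exact ne_top_of_le_ne_top this (negInt_anti (.of_forall h))

/-- To compare integrals of proper convex lower semicontinuous functions it suffices to
compare integrals of Lipschitz convex functions. -/
lemma extInt_le_extInt_of_lipConvex (hη : η ∈ P d 1) (hν : ν ∈ P d 1)
    (h : ∀ ψ ∈ LipConvex d, ∫ x, ψ x ∂η ≤ ∫ x, ψ x ∂ν) {φ : Rd d → EReal} (hφ : φ ∈ Acx d) :
    extInt φ η ≤ extInt φ ν := by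
  obtain ⟨ψ, hψ, hmono, hle, hlim⟩ := Acx.exists_lipConvex_approx hφ
  have hpos : ∀ μ : Measure (Rd d), μ ∈ P d 1 →
      Tendsto (fun n => posInt (fun x => (ψ n x : EReal)) μ) atTop (𝓝 (posInt φ μ)) := by
    intro μ hμ
    refine lintegral_tendsto_of_tendsto_of_monotone
      (fun n => (LipConvex.continuous (hψ n)).measurable.coe_real_ereal.ereal_toENNReal.aemeasurable)
      (.of_forall fun x m n hmn => EReal.toENNReal_le_toENNReal
        (EReal.coe_le_coe_iff.2 (hmono x hmn)))
      (.of_forall fun x => (EReal.continuous_toENNReal.tendsto _).comp (hlim x))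
  have hneg : ∀ μ : Measure (Rd d), μ ∈ P d 1 →
      Tendsto (fun n => negInt (fun x => (ψ n x : EReal)) μ) atTop (𝓝 (negInt φ μ)) := by
    intro μ hμ
    -- The approximants increase, so every negative part is dominated by that of ψ 0, which is
    -- integrable by the first moment.
    refine tendsto_lintegral_of_dominated_convergence
      (fun x => (-(ψ 0 x : EReal)).toENNReal)
      (fun n => (LipConvex.continuous (hψ n)).measurable.coe_real_ereal.neg.ereal_toENNReal)
      (fun n => .of_forall fun x => EReal.toENNReal_le_toENNReal
        (EReal.neg_le_neg_iff.2 (EReal.coe_le_coe_iff.2 (hmono x n.zero_le))))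
      (coe_mem_L1 (LipConvex.integrable (hψ 0) hμ)).2.2
      (.of_forall fun x => ((EReal.continuous_toENNReal.comp continuous_neg).tendsto _).comp
        (hlim x))
  rw [extInt_le_extInt_iff (Acx.negInt_ne_top hφ hη) (Acx.negInt_ne_top hφ hν)]
  refine le_of_tendsto_of_tendsto' ((hpos η hη).add (hneg ν hν)) ((hpos ν hν).add (hneg η hη))
    fun n => ?_
  have i1 := LipConvex.integrable (hψ n) hη
  have i2 := LipConvex.integrable (hψ n) hν
  rw [← extInt_le_extInt_iff (coe_mem_L1 i1).2.2 (coe_mem_L1 i2).2.2, extInt_coe i1, extInt_coe i2,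
    EReal.coe_le_coe_iff]
  exact h _ (hψ n)

lemma coe_mem_Acx {φ : Rd d → ℝ} (hφ : ConvexOn ℝ univ φ) : (fun x => (φ x : EReal)) ∈ Acx d := by
  refine ⟨fun x => by simp, ⟨0, by simp⟩, fun x y a b ha hb hab => ?_, ?_⟩
  · have := hφ.2 (mem_univ x) (mem_univ y) ha.le hb.le hab
    simpa only [smul_eq_mul, ← EReal.coe_mul, ← EReal.coe_add, EReal.coe_le_coe_iff] using this
  · exact (continuous_coe_real_ereal.comp (continuousOn_univ.1
      (hφ.continuousOn isOpen_univ))).lowerSemicontinuous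

lemma convexOrder_of_lipConvex (hη : η ∈ P d 1) (hν : ν ∈ P d 1)
    (h : ∀ ψ ∈ LipConvex d, ∫ x, ψ x ∂η ≤ ∫ x, ψ x ∂ν) : ConvexOrder η ν :=
  fun _ hφ _ _ => extInt_le_extInt_of_lipConvex hη hν h (coe_mem_Acx hφ)

/-- The order is defined by real-valued test functions; passing through Lipschitz ones reaches
functions that take the value +∞. -/
lemma ConvexOrder.extInt_le (h : ConvexOrder η ν) (hη : η ∈ P d 1) (hν : ν ∈ P d 1)
    {φ : Rd d → EReal} (hφ : φ ∈ Acx d) : extInt φ η ≤ extInt φ ν := by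
  refine extInt_le_extInt_of_lipConvex hη hν (fun ψ hψ => ?_) hφ
  have i1 := LipConvex.integrable hψ hη
  have i2 := LipConvex.integrable hψ hν
  have := h ψ hψ.1 ⟨(coe_mem_L1 i1).1, .inr (coe_mem_L1 i1).2.2⟩
    ⟨(coe_mem_L1 i2).1, .inr (coe_mem_L1 i2).2.2⟩
  rwa [extInt_coe i1, extInt_coe i2, EReal.coe_le_coe_iff] at this

end Moments

/-! ### Weak duality -/

section WeakDuality

variable {d : ℕ} {μ η ξ ν : Measure (Rd d)} {φ : Rd d → EReal} {π : Measure (Rd d × Rd d)}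

lemma mem_L1_of_le_of_le {f : Rd d → EReal} {u w : Rd d → ℝ} (hf : AEMeasurable f μ)
    (hu : Integrable u μ) (hw : Integrable w μ) (huf : ∀ᵐ x ∂μ, (u x : EReal) ≤ f x)
    (hfw : ∀ᵐ x ∂μ, f x ≤ (w x : EReal)) : f ∈ L1 μ :=
  ⟨hf, ne_top_of_le_ne_top (coe_mem_L1 hw).2.1 (posInt_mono hfw),
    ne_top_of_le_ne_top (coe_mem_L1 hu).2.2 (negInt_anti huf)⟩

lemma integrable_norm_sq (hμ : μ ∈ P d 2) : Integrable (fun x => ‖x‖ ^ 2) μ :=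
  (memLp_two_of_mem_P_two hμ).integrable_norm_pow (by simp)

lemma measurable_Q2 (hφ : φ ∈ Acx d) : Measurable (Q2 φ) := by
  have : UpperSemicontinuous (Q2 φ) := by
    have h : Q2 φ = fun x => ⨅ y : Rd d, φ y + ((‖x - y‖ ^ 2 : ℝ) : EReal) := rfl
    rw [h]
    refine upperSemicontinuous_iInf fun y => Continuous.upperSemicontinuous ?_
    by_cases hy : φ y = ⊤
    · simp only [hy, EReal.top_add_coe]
      exact continuous_const
    · rw [← Acx.coe_toReal hφ hy]
      simp only [← EReal.coe_add]
      exact continuous_coe_real_ereal.comp (by fun_prop)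
  exact this.measurable

/-- The quadratic cost absorbs the linear decrease of φ away from x, since C s ≤ s² + C²/4 with s =
‖x - y‖. -/
lemma le_Q2_of_linear_lower_bound {C : ℝ} (hC : 0 ≤ C)
    (h : ∀ x, ((-(C * (1 + ‖x‖)) : ℝ) : EReal) ≤ φ x) (x : Rd d) :
    ((-((C + C ^ 2) * (1 + ‖x‖)) : ℝ) : EReal) ≤ Q2 φ x := by
  refine le_iInf fun y => le_trans ?_ (add_le_add_left (h y) _)
  rw [← EReal.coe_add, EReal.coe_le_coe_iff]
  have h1 : ‖y‖ ≤ ‖x‖ + ‖x - y‖ := by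
    rw [norm_sub_rev]; exact norm_le_norm_add_norm_sub' _ _
  have h2 := mul_le_mul_of_nonneg_left h1 hC
  nlinarith [sq_nonneg (‖x - y‖ - C / 2), mul_nonneg (sq_nonneg C) (norm_nonneg x)]

lemma Q2_mem_L1 (hφ : φ ∈ Acx d) (hμ : μ ∈ P d 2) : Q2 φ ∈ L1 μ := by
  have := hμ.1
  obtain ⟨C, hC, h⟩ := Acx.exists_linear_lower_bound hφ
  obtain ⟨y, hy⟩ := hφ.2.1
  have i1 := integrable_norm_of_mem_P_one (P_two_subset_P_one hμ)
  have i2 := integrable_norm_sq hμ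
  refine mem_L1_of_le_of_le (measurable_Q2 hφ).aemeasurable
    (((integrable_const 1).add i1).const_mul (C + C ^ 2)).neg
    ((integrable_const ((φ y).toReal + 2 * ‖y‖ ^ 2)).add (i2.const_mul 2))
    (.of_forall (le_Q2_of_linear_lower_bound hC h)) (.of_forall fun x => ?_)
  refine (iInf_le _ y).trans ?_
  rw [← Acx.coe_toReal hφ hy, ← EReal.coe_add, EReal.coe_le_coe_iff]
  have h1 := norm_sub_le x y
  simp only [Pi.add_apply, EReal.toReal_coe]
  nlinarith [sq_nonneg (‖x‖ - ‖y‖), norm_nonneg (x - y)]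

lemma lintegral_sq_eq_integral (hc : ∫⁻ p, ‖p.1 - p.2‖ₑ ^ 2 ∂π ≠ ⊤) :
    Integrable (fun p : Rd d × Rd d => ‖p.1 - p.2‖ ^ 2) π ∧
      ((∫⁻ p, ‖p.1 - p.2‖ₑ ^ 2 ∂π : ℝ≥0∞) : EReal)
        = ((∫ p, ‖p.1 - p.2‖ ^ 2 ∂π : ℝ) : EReal) := by
  have hm : AEStronglyMeasurable (fun p : Rd d × Rd d => ‖p.1 - p.2‖ ^ 2) π :=
    (by fun_prop : Continuous fun p : Rd d × Rd d => ‖p.1 - p.2‖ ^ 2).aestronglyMeasurable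
  have he : ∀ p : Rd d × Rd d, ‖p.1 - p.2‖ₑ ^ 2 = ENNReal.ofReal (‖p.1 - p.2‖ ^ 2) := fun p => by
    rw [ENNReal.ofReal_pow (norm_nonneg _), ofReal_norm]
  simp_rw [he] at hc ⊢
  refine ⟨(lintegral_ofReal_ne_top_iff_integrable hm (.of_forall fun p => by positivity)).1 hc, ?_⟩
  rw [integral_eq_lintegral_of_nonneg_ae (.of_forall fun p => by positivity) hm,
    EReal.coe_ennreal_toReal hc]

lemma integrable_comp_fst (hπ : π ∈ couplings μ ν) {f : Rd d → ℝ} (hf : Integrable f μ) :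
    Integrable (fun p => f p.1) π ∧ ∫ p, f p.1 ∂π = ∫ x, f x ∂μ := by
  obtain ⟨-, rfl, -⟩ := hπ
  exact ⟨hf.comp_measurable measurable_fst, (integral_map measurable_fst.aemeasurable hf.1).symm⟩

lemma integrable_comp_snd (hπ : π ∈ couplings μ ν) {f : Rd d → ℝ} (hf : Integrable f ν) :
    Integrable (fun p => f p.2) π ∧ ∫ p, f p.2 ∂π = ∫ x, f x ∂ν := by
  obtain ⟨-, -, rfl⟩ := hπ
  exact ⟨hf.comp_measurable measurable_snd, (integral_map measurable_snd.aemeasurable hf.1).symm⟩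

lemma ae_comp_fst (hπ : π ∈ couplings μ ν) {p : Rd d → Prop} (h : ∀ᵐ x ∂μ, p x) :
    ∀ᵐ z ∂π, p z.1 := by
  obtain ⟨-, rfl, -⟩ := hπ
  exact ae_of_ae_map measurable_fst.aemeasurable h

lemma ae_comp_snd (hπ : π ∈ couplings μ ν) {p : Rd d → Prop} (h : ∀ᵐ x ∂ν, p x) :
    ∀ᵐ z ∂π, p z.2 := by
  obtain ⟨-, -, rfl⟩ := hπ
  exact ae_of_ae_map measurable_snd.aemeasurable h

/-- Integrate `Q2 φ x ≤ φ y + |x - y|²` against π. The convex order also transfers integrability of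
φ from ν to η, so every term is finite. -/
lemma backwardDual_le_lintegral (hμ : μ ∈ P d 2) (hη : η ∈ P d 1) (hν : ν ∈ P d 1)
    (hcx : ConvexOrder η ν) (hφ : φ ∈ Acx d) (hφν : φ ∈ L1 ν) (hπ : π ∈ couplings μ η) :
    backwardDual μ ν φ ≤ ((∫⁻ p, ‖p.1 - p.2‖ₑ ^ 2 ∂π : ℝ≥0∞) : EReal) := by
  by_cases hc : ∫⁻ p, ‖p.1 - p.2‖ₑ ^ 2 ∂π = ⊤
  · simp [hc]
  obtain ⟨hci, hce⟩ := lintegral_sq_eq_integral hc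
  have hle := ConvexOrder.extInt_le hcx hη hν hφ
  have hφη : φ ∈ L1 η := by
    refine ⟨(Acx.measurable hφ).aemeasurable, fun h => ?_, Acx.negInt_ne_top hφ hη⟩
    rw [extInt_le_extInt_iff (Acx.negInt_ne_top hφ hη) hφν.2.2, h, top_add, top_le_iff] at hle
    exact ENNReal.add_ne_top.2 ⟨hφν.2.1, Acx.negInt_ne_top hφ hη⟩ hle
  have hq := Q2_mem_L1 hφ hμ
  rw [extInt_of_mem_L1 hφη, extInt_of_mem_L1 hφν, EReal.coe_le_coe_iff] at hle
  rw [backwardDual, extInt_of_mem_L1 hq, extInt_of_mem_L1 hφν, hce, ← EReal.coe_sub,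
    EReal.coe_le_coe_iff]
  obtain ⟨i1, e1⟩ := integrable_comp_fst hπ (integrable_toReal hq)
  obtain ⟨i2, e2⟩ := integrable_comp_snd hπ (integrable_toReal hφη)
  have key : ∫ p, (Q2 φ p.1).toReal ∂π ≤ ∫ p, ((φ p.2).toReal + ‖p.1 - p.2‖ ^ 2) ∂π := by
    refine integral_mono_ae i1 (i2.add hci) ?_
    filter_upwards [ae_comp_fst hπ (ae_eq_coe_toReal hq), ae_comp_snd hπ (ae_eq_coe_toReal hφη)]
      with p h1 h2
    have h3 : Q2 φ p.1 ≤ φ p.2 + ((‖p.1 - p.2‖ ^ 2 : ℝ) : EReal) := iInf_le _ p.2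
    rw [h1, h2, ← EReal.coe_add, EReal.coe_le_coe_iff] at h3
    exact h3
  rw [integral_add i2 hci, e1, e2] at key
  linarith

lemma exists_of_mem_Sb_two (hφ : φ ∈ Sb d 2) :
    ∃ u : Rd d → ℝ, Measurable u ∧ (∃ C : ℝ, ∀ x, |u x| ≤ C * (1 + ‖x‖ ^ 2)) ∧
      φ = fun x => (u x : EReal) := by
  obtain ⟨u, hu, ⟨C, hC⟩, rfl⟩ := hφ
  exact ⟨u, hu, ⟨C, fun x => (div_le_iff₀ (by positivity)).1 (hC x)⟩, rfl⟩

lemma Sb_two_subset_L1 (hμ : μ ∈ P d 2) : Sb d 2 ⊆ L1 μ := by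
  intro φ hφ
  have := hμ.1
  obtain ⟨u, hu, ⟨C, hC⟩, rfl⟩ := exists_of_mem_Sb_two hφ
  exact coe_mem_L1 (((((integrable_const 1).add (integrable_norm_sq hμ)).const_mul C)).mono'
    hu.aestronglyMeasurable (.of_forall hC))

lemma Sb_subset_Sb_two {k : ℕ} (hk : k = 1 ∨ k = 2) : Sb d k ⊆ Sb d 2 := by
  rcases hk with rfl | rfl
  · rintro _ ⟨u, hu, ⟨C, hC⟩, rfl⟩
    refine ⟨u, hu, ⟨2 * |C|, fun x => ?_⟩, rfl⟩
    have h := (div_le_iff₀ (by positivity)).1 (hC x)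
    rw [div_le_iff₀ (by positivity)]
    refine h.trans ((mul_le_mul_of_nonneg_right (le_abs_self C) (by positivity)).trans ?_)
    nlinarith [abs_nonneg C, mul_nonneg (abs_nonneg C) (sq_nonneg (‖x‖ - 1)),
      mul_nonneg (abs_nonneg C) (sq_nonneg ‖x‖)]
  · exact subset_rfl

lemma Cb_one_subset_Cb {k : ℕ} (hk : k = 1 ∨ k = 2) : Cb d 1 ⊆ Cb d k := by
  rcases hk with rfl | rfl
  · exact subset_rfl
  · rintro _ ⟨u, hu, ⟨C, hC⟩, rfl⟩
    obtain ⟨w, hw, hb, he⟩ := Sb_subset_Sb_two (d := d) (.inl rfl) ⟨u, hu.measurable, ⟨C, hC⟩, rfl⟩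
    obtain rfl : u = w := funext fun x => EReal.coe_injective (congrFun he x)
    exact ⟨u, hu, hb, rfl⟩

lemma Cb_subset_Sb {k : ℕ} : Cb d k ⊆ Sb d k := by
  rintro _ ⟨u, hu, hb, rfl⟩
  exact ⟨u, hu.measurable, hb, rfl⟩

lemma le_Q2bar (φ : Rd d → EReal) (y : Rd d) : φ y ≤ Q2bar φ y := by
  refine le_trans ?_ (le_iSup _ y)
  simp

lemma measurable_Q2bar {u : Rd d → ℝ} : Measurable (Q2bar fun x => (u x : EReal)) := by
  refine (LowerSemicontinuous.measurable (f := Q2bar fun x => (u x : EReal)) ?_)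
  refine lowerSemicontinuous_iSup fun x => Continuous.lowerSemicontinuous ?_
  simp only [← EReal.coe_sub]
  exact continuous_coe_real_ereal.comp (by fun_prop)

lemma negInt_Q2bar_ne_top (hφ : φ ∈ Acx d) (hν : ν ∈ P d 1) : negInt (Q2bar φ) ν ≠ ⊤ :=
  ne_top_of_le_ne_top (Acx.negInt_ne_top hφ hν) (negInt_anti (.of_forall (le_Q2bar φ)))

lemma forwardDual_le_lintegral (hμ : μ ∈ P d 2) (hξ : ξ ∈ P d 1) (hν : ν ∈ P d 2)
    (hcx : ConvexOrder μ ξ) (hφ : φ ∈ Acx d) (hφb : φ ∈ Sb d 2) (hπ : π ∈ couplings ξ ν) :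
    forwardDual μ ν φ ≤ ((∫⁻ p, ‖p.1 - p.2‖ₑ ^ 2 ∂π : ℝ≥0∞) : EReal) := by
  have := hξ.1
  by_cases hc : ∫⁻ p, ‖p.1 - p.2‖ₑ ^ 2 ∂π = ⊤
  · simp [hc]
  obtain ⟨hci, hce⟩ := lintegral_sq_eq_integral hc
  have hφμ := Sb_two_subset_L1 hμ hφb
  have hle := ConvexOrder.extInt_le hcx (P_two_subset_P_one hμ) hξ hφ
  obtain ⟨u, hu, ⟨K, hK⟩, rfl⟩ := exists_of_mem_Sb_two hφb
  have hneg := negInt_Q2bar_ne_top hφ (P_two_subset_P_one hν)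
  -- If ∫ `Q2bar φ` dν = +∞, the dual value is -∞.
  by_cases hq : posInt (Q2bar fun x => (u x : EReal)) ν = ⊤
  · lift negInt (Q2bar fun x => (u x : EReal)) ν to NNReal using hneg with r hr
    rw [forwardDual, extInt_of_mem_L1 hφμ, extInt, hq, ← hr, EReal.coe_ennreal_top,
      EReal.coe_nnreal_eq_coe_real, EReal.top_sub_coe, EReal.sub_top]
    exact bot_le
  have hQ : (Q2bar fun x => (u x : EReal)) ∈ L1 ν := ⟨measurable_Q2bar.aemeasurable, hq, hneg⟩
  obtain ⟨i2, e2⟩ := integrable_comp_snd hπ (integrable_toReal hQ)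
  have hae : ∀ᵐ p ∂π,
      u p.1 ≤ (Q2bar (fun x => (u x : EReal)) p.2).toReal + ‖p.1 - p.2‖ ^ 2 := by
    filter_upwards [ae_comp_snd hπ (ae_eq_coe_toReal hQ)] with p h
    have h3 : (u p.1 : EReal) - ((‖p.1 - p.2‖ ^ 2 : ℝ) : EReal)
      ≤ Q2bar (fun x => (u x : EReal)) p.2 := le_iSup
        (fun x => (u x : EReal) - ((‖x - p.2‖ ^ 2 : ℝ) : EReal)) p.1
    rw [h, ← EReal.coe_sub, EReal.coe_le_coe_iff] at h3
    linarith
  obtain ⟨C, hC, hlow⟩ := Acx.exists_linear_lower_bound hφ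
  -- Here u may grow quadratically while ξ has only a first moment. Integrability comes from the
  -- bound `hae` above and the linear minorant below.
  have iu : Integrable u ξ := by
    have h1 : Integrable (fun p => u p.1) π := by
      have i3 := (integrable_comp_fst hπ (((integrable_const 1).add
        (integrable_norm_of_mem_P_one hξ)).const_mul C)).1
      refine ((i2.add hci).abs.add i3.abs).mono'
        (hu.comp measurable_fst).aestronglyMeasurable ?_
      filter_upwards [hae] with p hp
      have h4 := EReal.coe_le_coe_iff.1 (hlow p.1)
      simp only [Pi.add_apply, Real.norm_eq_abs]
      refine abs_le.2 ⟨?_, ?_⟩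
      · linarith [le_abs_self (C * (1 + ‖p.1‖)), abs_nonneg
          ((Q2bar (fun x => (u x : EReal)) p.2).toReal + ‖p.1 - p.2‖ ^ 2)]
      · linarith [abs_nonneg (C * (1 + ‖p.1‖)), le_abs_self
          ((Q2bar (fun x => (u x : EReal)) p.2).toReal + ‖p.1 - p.2‖ ^ 2)]
    rw [← hπ.2.1]
    exact (integrable_map_measure hu.aestronglyMeasurable measurable_fst.aemeasurable).2 h1
  obtain ⟨i1, e1⟩ := integrable_comp_fst hπ iu
  have hs := integral_mono_ae i1 (i2.add hci) hae
  simp only [Pi.add_apply] at hs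
  rw [e1, integral_add i2 hci, e2] at hs
  rw [extInt_coe iu] at hle
  rw [forwardDual, extInt_of_mem_L1 hQ, hce]
  have hμu : Integrable u μ := by simpa using integrable_toReal hφμ
  rw [extInt_coe hμu, EReal.coe_le_coe_iff] at *
  rw [← EReal.coe_sub, EReal.coe_le_coe_iff]
  linarith

/-- A possibly negative r is replaced by its positive part, which lives in `ℝ≥0∞`. -/
lemma EReal_le_coe_iInf {ι : Sort*} {r : EReal} {f : ι → ℝ≥0∞} (h : ∀ i, r ≤ f i) :
    r ≤ ((⨅ i, f i : ℝ≥0∞) : EReal) := by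
  have h1 : r ≤ (r.toENNReal : EReal) := by
    rw [EReal.coe_toENNReal_eq_max]
    exact le_max_right 0 r
  refine h1.trans (EReal.coe_ennreal_le_coe_ennreal_iff.2 (le_iInf fun i => ?_))
  simpa using EReal.toENNReal_le_toENNReal (h i)

lemma cone_one_of_cone {k : ℕ} (hk : k = 1 ∨ k = 2) (h : η ∈ P d k) : η ∈ P d 1 := by
  rcases hk with rfl | rfl
  · exact h
  · exact P_two_subset_P_one h

theorem backwardDual_le_T2Backward {k : ℕ} (hk : k = 1 ∨ k = 2) (hμ : μ ∈ P d 2) (hν : ν ∈ P d 1)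
    (hφ : φ ∈ Acx d) (hφν : φ ∈ L1 ν) : backwardDual μ ν φ ≤ (T2Backward k μ ν : EReal) :=
  EReal_le_coe_iInf fun _ => EReal_le_coe_iInf fun hη => EReal_le_coe_iInf fun _ =>
    EReal_le_coe_iInf fun hπ =>
      backwardDual_le_lintegral hμ (cone_one_of_cone hk hη.1) hν hη.2 hφ hφν hπ

theorem forwardDual_le_T2Forward {k : ℕ} (hk : k = 1 ∨ k = 2) (hμ : μ ∈ P d 2) (hν : ν ∈ P d 2)
    (hφ : φ ∈ Acx d) (hφb : φ ∈ Sb d 2) : forwardDual μ ν φ ≤ (T2Forward k μ ν : EReal) :=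
  EReal_le_coe_iInf fun _ => EReal_le_coe_iInf fun hξ => EReal_le_coe_iInf fun _ =>
    EReal_le_coe_iInf fun hπ =>
      forwardDual_le_lintegral hμ (cone_one_of_cone hk hξ.1) hν hξ.2 hφ hφb hπ

end WeakDuality

/-! ### Proximal maps of Lipschitz convex functions -/

section Prox

variable {d : ℕ} {φ ψ : Rd d → ℝ} {μ ν : Measure (Rd d)}

lemma LipConvex.zero_mem : (0 : Rd d → ℝ) ∈ LipConvex d :=
  ⟨convexOn_const 0 convex_univ, 0, le_rfl, by simp⟩

lemma LipConvex.add_mem (hφ : φ ∈ LipConvex d) (hψ : ψ ∈ LipConvex d) : φ + ψ ∈ LipConvex d := by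
  obtain ⟨h1, L, hL, h⟩ := hφ
  obtain ⟨h2, K, hK, k⟩ := hψ
  refine ⟨h1.add h2, L + K, by positivity, fun x y => ?_⟩
  simp only [Pi.add_apply]
  linarith [h x y, k x y]

lemma LipConvex.smul_mem (hφ : φ ∈ LipConvex d) {c : ℝ} (hc : 0 ≤ c) : c • φ ∈ LipConvex d := by
  obtain ⟨h1, L, hL, h⟩ := hφ
  refine ⟨h1.smul hc, c * L, by positivity, fun x y => ?_⟩
  simp only [Pi.smul_apply, smul_eq_mul]
  nlinarith [mul_le_mul_of_nonneg_left (h x y) hc]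

lemma LipConvex.convex : Convex ℝ (LipConvex d) := fun _ hφ _ hψ _ _ ha hb _ =>
  LipConvex.add_mem (LipConvex.smul_mem hφ ha) (LipConvex.smul_mem hψ hb)

lemma LipConvex.coe_mem_Cb_one (hφ : φ ∈ LipConvex d) : (fun x => (φ x : EReal)) ∈ Cb d 1 := by
  refine ⟨φ, LipConvex.continuous hφ, ?_, rfl⟩
  obtain ⟨-, L, hL, h⟩ := hφ
  refine ⟨|φ 0| + L, fun x => ?_⟩
  rw [div_le_iff₀ (by positivity), pow_one]
  have h1 := h x 0
  have h2 := h 0 x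
  rw [sub_zero] at h1
  rw [zero_sub, norm_neg] at h2
  have h3 := mul_nonneg (abs_nonneg (φ 0)) (norm_nonneg x)
  refine abs_le.2 ⟨?_, ?_⟩ <;> nlinarith [neg_abs_le (φ 0), le_abs_self (φ 0)]

/-- Existence and quadratic growth at the proximal point. -/
lemma LipConvex.exists_prox_point (hφ : φ ∈ LipConvex d) (x : Rd d) :
    ∃ z, ∀ y, φ z + ‖x - z‖ ^ 2 + ‖y - z‖ ^ 2 / 2 ≤ φ y + ‖x - y‖ ^ 2 := by
  have hcont := LipConvex.continuous hφ
  obtain ⟨hconv, L, hL, h⟩ := hφ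
  -- Coercivity: for ‖x - y‖ > L the quadratic term exceeds L‖x - y‖ ≥ φ x - φ y, so y does no
  -- better than x.
  obtain ⟨z, hz⟩ := Continuous.exists_forall_le' (f := fun y => φ y + ‖x - y‖ ^ 2)
    (by fun_prop) x (by
      filter_upwards [(isCompact_closedBall x L).compl_mem_cocompact] with y hy
      have hy' : L < ‖x - y‖ := by
        simpa [dist_eq_norm, norm_sub_rev] using hy
      have := h x y
      simp only [sub_self, norm_zero]
      nlinarith)
  -- Minimality of z is tested at the midpoint of y and z; convexity and the parallelogram law then
  -- give the growth constant 1/2.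
  refine ⟨z, fun y => ?_⟩
  have h1 := hz ((1 / 2 : ℝ) • y + (1 / 2 : ℝ) • z)
  have h2 := hconv.2 (mem_univ y) (mem_univ z) (by norm_num : (0 : ℝ) ≤ 1 / 2)
    (by norm_num : (0 : ℝ) ≤ 1 / 2) (by norm_num)
  have h3 := parallelogram_law_with_norm ℝ (x - y) (x - z)
  have e1 : x - ((1 / 2 : ℝ) • y + (1 / 2 : ℝ) • z) = (1 / 2 : ℝ) • ((x - y) + (x - z)) := by module
  have e2 : (x - y) - (x - z) = -(y - z) := by abel
  rw [e2, norm_neg] at h3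
  simp only [e1, norm_smul, smul_eq_mul] at h1 h2
  norm_num at h1 h2
  nlinarith

/-- The proximal map. -/
lemma LipConvex.exists_prox (hφ : φ ∈ LipConvex d) :
    ∃ p : Rd d → Rd d, (∀ x y, ‖p x - p y‖ ≤ 2 * ‖x - y‖) ∧
      ∀ x y, φ (p x) + ‖x - p x‖ ^ 2 + ‖y - p x‖ ^ 2 / 2 ≤ φ y + ‖x - y‖ ^ 2 := by
  choose p hp using LipConvex.exists_prox_point hφ
  refine ⟨p, fun x y => ?_, hp⟩
  -- Adding the two growth inequalities cancels φ and leaves ‖p x - p y‖² ≤ 2⟨x - y, p x - p y⟩.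
  have h1 := hp x (p y)
  have h2 := hp y (p x)
  have h3 : ‖x - p y‖ ^ 2 + ‖y - p x‖ ^ 2 - ‖x - p x‖ ^ 2 - ‖y - p y‖ ^ 2
      = 2 * inner ℝ (x - y) (p x - p y) := by
    simp only [norm_sub_sq_real, inner_sub_left, inner_sub_right]
    ring
  have h4 := real_inner_le_norm (x - y) (p x - p y)
  rw [norm_sub_rev (p y) (p x)] at h1
  by_contra! hlt
  nlinarith [norm_nonneg (x - y), norm_nonneg (p x - p y)]

lemma Q2_coe_eq {x z : Rd d} (hz : ∀ y, φ z + ‖x - z‖ ^ 2 ≤ φ y + ‖x - y‖ ^ 2) :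
    Q2 (fun x => (φ x : EReal)) x = ((φ z + ‖x - z‖ ^ 2 : ℝ) : EReal) := by
  refine le_antisymm (iInf_le_of_le z (by simp)) (le_iInf fun y => ?_)
  rw [← EReal.coe_add, EReal.coe_le_coe_iff]
  exact hz y

/-- The infimal convolution of a Lipschitz convex function with the squared norm is again
Lipschitz convex. -/
lemma LipConvex.exists_Q2_eq (hφ : φ ∈ LipConvex d) :
    ∃ q ∈ LipConvex d, Q2 (fun x => (φ x : EReal)) = fun x => (q x : EReal) := by
  obtain ⟨p, -, hp⟩ := LipConvex.exists_prox hφ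
  have hle : ∀ x y, φ (p x) + ‖x - p x‖ ^ 2 ≤ φ y + ‖x - y‖ ^ 2 := fun x y => by
    have := hp x y
    nlinarith [sq_nonneg ‖y - p x‖]
  refine ⟨fun x => φ (p x) + ‖x - p x‖ ^ 2, ⟨⟨convex_univ, fun x _ y _ a b ha hb hab => ?_⟩, ?_⟩,
    funext fun x => Q2_coe_eq (hle x)⟩
  · refine (hle _ (a • p x + b • p y)).trans ?_
    have h1 := hφ.1.2 (mem_univ (p x)) (mem_univ (p y)) ha hb hab
    have e1 : a • x + b • y - (a • p x + b • p y) = a • (x - p x) + b • (y - p y) := by module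
    have h2 := (convexOn_univ_norm (E := Rd d)).pow (fun _ _ => norm_nonneg _) 2 |>.2
      (mem_univ (x - p x)) (mem_univ (y - p y)) ha hb hab
    simp only [e1, smul_eq_mul, Pi.pow_apply] at *
    linarith
  · obtain ⟨-, L, hL, h⟩ := hφ
    refine ⟨L, hL, fun x y => ?_⟩
    -- This competitor gives x the same displacement as y, so the quadratic terms cancel and only
    -- the Lipschitz bound of φ remains.
    have h1 := hle x (x - (y - p y))
    have h2 := h (x - (y - p y)) (p y)
    have e1 : x - (x - (y - p y)) = y - p y := by abel
    have e2 : x - (y - p y) - p y = x - y := by abel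
    rw [e1] at h1
    rw [e2] at h2
    linarith

end Prox

/-! ### Minimax by quadratic growth -/

section Minimax

/-- A minimax principle: if each `F φ` grows quadratically away from a minimizer `p φ` and `F` is
affine in `φ`, then the value `sup_φ min F φ` is attained by a single point. -/
theorem exists_forall_le_of_quadratic_growth {V H : Type*} [AddCommGroup V] [Module ℝ V]
    [NormedAddCommGroup H] [CompleteSpace H] {Λ : Set V} (hΛ : Convex ℝ Λ) (hne : Λ.Nonempty)
    {F : V → H → ℝ}
    (hF : ∀ φ ∈ Λ, ∀ ψ ∈ Λ, ∀ a b : ℝ, 0 ≤ a → 0 ≤ b → a + b = 1 → ∀ m,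
      F (a • φ + b • ψ) m = a * F φ m + b * F ψ m)
    (hcont : ∀ φ ∈ Λ, Continuous (F φ)) {p : V → H} {c : ℝ} (hc : 0 < c)
    (hp : ∀ φ ∈ Λ, ∀ m, F φ (p φ) + c * ‖m - p φ‖ ^ 2 ≤ F φ m) {w : ℝ}
    (hw : ∀ φ ∈ Λ, F φ (p φ) ≤ w) : ∃ m, ∀ φ ∈ Λ, F φ m ≤ w := by
  have hbdd : BddAbove ((fun φ => F φ (p φ)) '' Λ) := ⟨w, by rintro _ ⟨φ, hφ, rfl⟩; exact hw φ hφ⟩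
  set v := sSup ((fun φ => F φ (p φ)) '' Λ)
  have hvw : v ≤ w := csSup_le (hne.image _) (by rintro _ ⟨φ, hφ, rfl⟩; exact hw φ hφ)
  have hv : ∀ φ ∈ Λ, F φ (p φ) ≤ v := fun φ hφ => le_csSup hbdd ⟨φ, hφ, rfl⟩
  let t : ℕ → ℝ := fun n => 1 / ((n : ℝ) + 2)
  have ht0 : ∀ n, 0 < t n := fun n => by positivity
  have ht1 : ∀ n, t n ≤ 1 / 2 := fun n => by
    simp only [t]; gcongr; linarith [(Nat.cast_nonneg n : (0 : ℝ) ≤ n)]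
  have hanti : ∀ {m n}, m ≤ n → t n ≤ t m := fun {m n} h => by
    have : (m : ℝ) ≤ n := by exact_mod_cast h
    simp only [t]; gcongr
  have htlim : Tendsto t atTop (𝓝 0) := by
    have := (tendsto_const_div_atTop_nhds_zero_nat (1 : ℝ)).comp (tendsto_add_atTop_nat 2)
    refine this.congr fun n => ?_
    simp [t]
  -- The error t² is of smaller order than the mixing weight t used later, so it still vanishes
  -- after division by t.
  have hex : ∀ n, ∃ φ ∈ Λ, v - t n ^ 2 < F φ (p φ) := fun n => by
    obtain ⟨_, ⟨φ, hφ, rfl⟩, h⟩ := exists_lt_of_lt_csSup (hne.image fun φ => F φ (p φ))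
      (sub_lt_self v (pow_pos (ht0 n) 2))
    exact ⟨φ, hφ, h⟩
  choose φ hφΛ hφ using hex
  -- The minimal value of a mixture of φ n and ψ is at most v, whereas φ n contributes at least v -
  -- t² plus its growth term.
  have hmain : ∀ n, ∀ ψ ∈ Λ, ∀ s : ℝ, 0 ≤ s → s ≤ 1 → ∀ m, m = p ((1 - s) • φ n + s • ψ) →
      (1 - s) * (v - t n ^ 2 + c * ‖m - p (φ n)‖ ^ 2) + s * F ψ m ≤ v := by
    intro n ψ hψ s hs hs1 m hm
    have h1 := hv _ (hΛ (hφΛ n) hψ (sub_nonneg.2 hs1) hs (by ring))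
    rw [← hm, hF _ (hφΛ n) _ hψ _ _ (sub_nonneg.2 hs1) hs (by ring)] at h1
    have h2 := hp _ (hφΛ n) m
    have h3 := hφ n
    have h4 := mul_le_mul_of_nonneg_left
      (by linarith : v - t n ^ 2 + c * ‖m - p (φ n)‖ ^ 2 ≤ F (φ n) m) (sub_nonneg.2 hs1)
    linarith
  have hcauchy : CauchySeq fun n => p (φ n) := by
    refine cauchySeq_of_le_tendsto_0 (fun N => Real.sqrt (4 * t N ^ 2 / c)) (fun n k N hn hk => ?_) ?_
    · rw [dist_eq_norm]
      refine Real.le_sqrt_of_sq_le ?_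
      rw [le_div_iff₀ hc]
      -- The minimizer of the half-half mixture must be close to both p (φ n) and p (φ k).
      have h1 := hmain n (φ k) (hφΛ k) (1 / 2) (by norm_num) (by norm_num) _ rfl
      set m := p ((1 - 1 / 2 : ℝ) • φ n + (1 / 2 : ℝ) • φ k)
      have h2 := hp _ (hφΛ k) m
      have h3 := hφ k
      have h4 : ‖p (φ n) - p (φ k)‖ ≤ ‖m - p (φ n)‖ + ‖m - p (φ k)‖ := by
        rw [norm_sub_rev m (p (φ n))]; exact norm_sub_le_norm_sub_add_norm_sub _ _ _
      have h5 : ‖p (φ n) - p (φ k)‖ ^ 2 ≤ 2 * (‖m - p (φ n)‖ ^ 2 + ‖m - p (φ k)‖ ^ 2) := by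
        refine (pow_le_pow_left₀ (norm_nonneg _) h4 2).trans ?_
        nlinarith [sq_nonneg (‖m - p (φ n)‖ - ‖m - p (φ k)‖)]
      have h6 := pow_le_pow_left₀ (ht0 n).le (hanti hn) 2
      have h7 := pow_le_pow_left₀ (ht0 k).le (hanti hk) 2
      nlinarith
    · have : Tendsto (fun N => 4 * t N ^ 2 / c) atTop (𝓝 (4 * 0 ^ 2 / c)) :=
        ((htlim.pow 2).const_mul 4).div_const c
      simpa using this.sqrt
  obtain ⟨m₀, hm₀⟩ := cauchySeq_tendsto_of_complete hcauchy
  refine ⟨m₀, fun ψ hψ => le_trans ?_ hvw⟩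
  -- Mixing in an arbitrary ψ with weight t n → 0 moves the minimizer by o(1), so m n has the same
  -- limit m₀; dividing `hm` by t n gives F ψ (m n) ≤ v + t n.
  let m : ℕ → H := fun n => p ((1 - t n) • φ n + t n • ψ)
  have hm : ∀ n, (1 - t n) * (v - t n ^ 2 + c * ‖m n - p (φ n)‖ ^ 2) + t n * F ψ (m n) ≤ v :=
    fun n => hmain n ψ hψ (t n) (ht0 n).le ((ht1 n).trans (by norm_num)) _ rfl
  have hdist : ∀ n, ‖m n - p (φ n)‖
      ≤ Real.sqrt ((2 * t n ^ 2 + 2 * t n * (v - F ψ (p ψ))) / c) := fun n => by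
    refine Real.le_sqrt_of_sq_le ?_
    rw [le_div_iff₀ hc]
    have h1 := hm n
    have h2 : F ψ (p ψ) ≤ F ψ (m n) := le_trans (by
      have := sq_nonneg ‖m n - p ψ‖; nlinarith) (hp ψ hψ (m n))
    have h3 := mul_le_mul_of_nonneg_left h2 (ht0 n).le
    have h4 : (1 / 2) * (c * ‖m n - p (φ n)‖ ^ 2) ≤ (1 - t n) * (c * ‖m n - p (φ n)‖ ^ 2) :=
      mul_le_mul_of_nonneg_right (by linarith [ht1 n]) (by positivity)
    nlinarith [mul_nonneg (ht0 n).le (sq_nonneg (t n))]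
  have hdiff : Tendsto (fun n => m n - p (φ n)) atTop (𝓝 0) := by
    refine squeeze_zero_norm hdist ?_
    have : Tendsto (fun n => (2 * t n ^ 2 + 2 * t n * (v - F ψ (p ψ))) / c) atTop
        (𝓝 ((2 * 0 ^ 2 + 2 * 0 * (v - F ψ (p ψ))) / c)) :=
      (((htlim.pow 2).const_mul 2).add ((htlim.const_mul 2).mul_const _)).div_const c
    simpa using this.sqrt
  have hmlim : Tendsto m atTop (𝓝 m₀) := by
    simpa using hdiff.add hm₀
  have h1 : Tendsto (fun n => v + t n) atTop (𝓝 (v + 0)) := htlim.const_add v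
  rw [add_zero] at h1
  refine le_of_tendsto_of_tendsto' (((hcont ψ hψ).tendsto m₀).comp hmlim) h1 fun n => ?_
  have h2 := hm n
  have h3 : 0 ≤ (1 - t n) * (c * ‖m n - p (φ n)‖ ^ 2) :=
    mul_nonneg (by linarith [ht1 n]) (by positivity)
  have h4 := ht0 n
  refine le_of_mul_le_mul_left ?_ h4
  simp only [Function.comp_apply]
  nlinarith [mul_nonneg h4.le (sq_nonneg (t n))]

end Minimax

/-! ### The optimal map in L²(μ) and the backward cost -/

section BackwardProjection

variable {d : ℕ} {φ : Rd d → ℝ} {μ ν : Measure (Rd d)}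

lemma L2_norm_sub_sq (f g : Lp (Rd d) 2 μ) : ‖f - g‖ ^ 2 = ∫ x, ‖f x - g x‖ ^ 2 ∂μ := by
  rw [← real_inner_self_eq_norm_sq, L2.inner_def]
  refine integral_congr_ae ?_
  filter_upwards [Lp.coeFn_sub f g] with x hx
  rw [real_inner_self_eq_norm_sq, hx, Pi.sub_apply]

lemma integrable_norm_sub_sq {f g : Rd d → Rd d} (hf : MemLp f 2 μ) (hg : MemLp g 2 μ) :
    Integrable (fun x => ‖f x - g x‖ ^ 2) μ :=
  (hf.sub hg).integrable_norm_pow (by simp)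

lemma LipConvex.continuous_integral_comp [IsProbabilityMeasure μ] (hφ : φ ∈ LipConvex d) :
    Continuous fun m : Lp (Rd d) 2 μ => ∫ x, φ (m x) ∂μ := by
  have hi : ∀ m : Lp (Rd d) 2 μ, Integrable (fun x => φ (m x)) μ := fun m =>
    LipConvex.integrable_comp hφ ((Lp.memLp m).integrable one_le_two)
  obtain ⟨L, hL, h⟩ := hφ.2
  have hle : ∀ m k : Lp (Rd d) 2 μ, ∫ x, φ (m x) ∂μ - ∫ x, φ (k x) ∂μ ≤ L * ‖m - k‖ := by
    intro m k
    have hmk : Integrable (fun x => ‖m x - k x‖) μ :=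
      (((Lp.memLp m).integrable one_le_two).sub ((Lp.memLp k).integrable one_le_two)).norm
    rw [← integral_sub (hi m) (hi k)]
    refine (integral_mono ((hi m).sub (hi k)) (hmk.const_mul L) fun x => h _ _).trans ?_
    rw [integral_const_mul]
    refine mul_le_mul_of_nonneg_left ?_ hL
    have hae : ∫ x, ‖m x - k x‖ ∂μ = ∫ x, ‖(m - k : Lp (Rd d) 2 μ) x‖ ∂μ :=
      integral_congr_ae ((Lp.coeFn_sub m k).mono fun x hx => by simp only [hx, Pi.sub_apply])
    rw [hae, integral_norm_eq_lintegral_enorm (Lp.aestronglyMeasurable _),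
      ← eLpNorm_one_eq_lintegral_enorm, Lp.norm_def]
    exact ENNReal.toReal_mono (Lp.eLpNorm_ne_top _)
      (eLpNorm_le_eLpNorm_of_exponent_le one_le_two (Lp.aestronglyMeasurable _))
  refine (LipschitzWith.of_dist_le_mul (K := ⟨L, hL⟩) fun m k => ?_).continuous
  rw [Real.dist_eq, dist_eq_norm]
  exact abs_sub_le_iff.2 ⟨hle m k, norm_sub_rev m k ▸ hle k m⟩

/-- If the dual values are bounded by `w`, there is a map `m` at squared distance at most `w` from
the identity, whose law is dominated by `ν` on Lipschitz convex functions. -/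
theorem exists_map_of_backwardDual_le (hμ : μ ∈ P d 2) (hν : ν ∈ P d 1) {w : ℝ}
    (hw : ∀ φ ∈ LipConvex d, backwardDual μ ν (fun x => (φ x : EReal)) ≤ (w : EReal)) :
    ∃ m : Rd d → Rd d, Measurable m ∧ MemLp m 2 μ ∧ ∫ x, ‖x - m x‖ ^ 2 ∂μ ≤ w ∧
      ∀ φ ∈ LipConvex d, ∫ x, φ (m x) ∂μ ≤ ∫ x, φ x ∂ν := by
  have := hμ.1
  have := hν.1
  have hid := memLp_two_of_mem_P_two hμ
  let J : Lp (Rd d) 2 μ := hid.toLp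
  have hJ : J =ᵐ[μ] fun x => x := hid.coeFn_toLp
  have hJm : ∀ m : Lp (Rd d) 2 μ, ‖J - m‖ ^ 2 = ∫ x, ‖x - m x‖ ^ 2 ∂μ := fun m => by
    rw [L2_norm_sub_sq]
    exact integral_congr_ae (hJ.mono fun x hx => by simp only [hx])
  have hi : ∀ φ ∈ LipConvex d, ∀ m : Rd d → Rd d, MemLp m 2 μ →
      Integrable (fun x => φ (m x)) μ := fun φ hφ m hm =>
    LipConvex.integrable_comp hφ (hm.integrable one_le_two)
  have hi' : ∀ φ ∈ LipConvex d, Integrable φ ν := fun φ hφ => LipConvex.integrable hφ hν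
  -- Minimizing pointwise in m turns F φ into ∫ Q₂(φ) dμ - ∫ φ dν.
  let F : (Rd d → ℝ) → Lp (Rd d) 2 μ → ℝ := fun φ m =>
    ∫ x, φ (m x) ∂μ + ‖J - m‖ ^ 2 - ∫ x, φ x ∂ν
  have hprox : ∀ φ : Rd d → ℝ, ∃ p : Lp (Rd d) 2 μ, φ ∈ LipConvex d →
      (∀ m, F φ p + 1 / 2 * ‖m - p‖ ^ 2 ≤ F φ m) ∧ F φ p ≤ w := by
    intro φ
    by_cases hφ : φ ∈ LipConvex d
    swap
    · exact ⟨0, fun h => absurd h hφ⟩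
    obtain ⟨p, hlip, hp⟩ := LipConvex.exists_prox hφ
    have hpc : Continuous p := (LipschitzWith.of_dist_le_mul (K := 2) fun x y => by
      rw [dist_eq_norm, dist_eq_norm]; exact hlip x y).continuous
    have hpL : MemLp p 2 μ := by
      have h1 : MemLp (fun x => p x - p 0) 2 μ :=
        hid.of_le_mul (c := 2) (hpc.sub continuous_const).aestronglyMeasurable
          (.of_forall fun x => by simpa using hlip x 0)
      have h2 := h1.add (memLp_const (p 0))
      exact h2.ae_eq (.of_forall fun x => by simp)
    have hpe := hpL.coeFn_toLp
    have hFp : F φ hpL.toLp = ∫ x, (φ (p x) + ‖x - p x‖ ^ 2) ∂μ - ∫ x, φ x ∂ν := by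
      simp only [F]
      rw [hJm, integral_add (hi φ hφ p hpL) (integrable_norm_sub_sq hid hpL)]
      congr 2
      · exact integral_congr_ae (hpe.mono fun x hx => by simp only [hx])
      · exact integral_congr_ae (hpe.mono fun x hx => by simp only [hx])
    have hQi : Integrable (fun x => φ (p x) + ‖x - p x‖ ^ 2) μ :=
      (hi φ hφ p hpL).add (integrable_norm_sub_sq hid hpL)
    refine ⟨hpL.toLp, fun _ => ⟨fun m => ?_, ?_⟩⟩
    · rw [hFp, L2_norm_sub_sq]
      have hm := Lp.memLp m
      have i1 := integrable_norm_sub_sq hm (Lp.memLp hpL.toLp)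
      have i2 := (hi φ hφ m hm).add (integrable_norm_sub_sq hid hm)
      have h1 : ∫ x, (φ (p x) + ‖x - p x‖ ^ 2 + 1 / 2 * ‖m x - hpL.toLp p x‖ ^ 2) ∂μ
          ≤ ∫ x, (φ (m x) + ‖x - m x‖ ^ 2) ∂μ := by
        refine integral_mono_ae (hQi.add (i1.const_mul _)) i2 ?_
        filter_upwards [hpe] with x hx
        have := hp x (m x)
        simp only [hx]
        linarith
      rw [integral_add hQi (i1.const_mul _), integral_const_mul,
        integral_add (hi φ hφ m hm) (integrable_norm_sub_sq hid hm)] at h1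
      simp only [F]
      rw [hJm]
      linarith
    · have h1 := hw φ hφ
      have h2 : Q2 (fun x => (φ x : EReal)) = fun x => ((φ (p x) + ‖x - p x‖ ^ 2 : ℝ) : EReal) :=
        funext fun x => Q2_coe_eq fun y => by
          have := hp x y
          nlinarith [sq_nonneg ‖y - p x‖]
      rw [backwardDual, h2, extInt_coe hQi, extInt_coe (hi' φ hφ), ← EReal.coe_sub,
        EReal.coe_le_coe_iff] at h1
      rwa [hFp]
  choose p hp using hprox
  obtain ⟨m, hm⟩ := exists_forall_le_of_quadratic_growth (F := F) LipConvex.convex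
    ⟨0, LipConvex.zero_mem⟩ (p := p) (c := 1 / 2) (w := w) (by
      intro φ hφ ψ hψ a b _ _ hab m
      have hm := Lp.memLp m
      have e1 : ∫ x, (a • φ + b • ψ) (m x) ∂μ = a * ∫ x, φ (m x) ∂μ + b * ∫ x, ψ (m x) ∂μ := by
        simp only [Pi.add_apply, Pi.smul_apply, smul_eq_mul]
        rw [integral_add ((hi φ hφ m hm).const_mul a) ((hi ψ hψ m hm).const_mul b),
          integral_const_mul, integral_const_mul]
      have e2 : ∫ x, (a • φ + b • ψ) x ∂ν = a * ∫ x, φ x ∂ν + b * ∫ x, ψ x ∂ν := by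
        simp only [Pi.add_apply, Pi.smul_apply, smul_eq_mul]
        rw [integral_add ((hi' φ hφ).const_mul a) ((hi' ψ hψ).const_mul b),
          integral_const_mul, integral_const_mul]
      simp only [F]
      rw [e1, e2]
      obtain rfl : b = 1 - a := by linarith
      ring)
    (fun φ hφ => ((LipConvex.continuous_integral_comp hφ).add (by fun_prop)).sub continuous_const)
    (by norm_num) (fun φ hφ => (hp φ hφ).1) (fun φ hφ => (hp φ hφ).2)
  refine ⟨m, (Lp.stronglyMeasurable m).measurable, Lp.memLp m, ?_, fun φ hφ => ?_⟩
  · have := hm 0 LipConvex.zero_mem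
    simpa [F, hJm] using this
  · by_contra! hlt
    -- The test functions form a cone: a positive gap for φ would exceed w once multiplied by a
    -- large n.
    obtain ⟨n, hn⟩ := exists_nat_gt (w / (∫ x, φ (m x) ∂μ - ∫ x, φ x ∂ν))
    rw [div_lt_iff₀ (sub_pos.2 hlt)] at hn
    have h1 := hm ((n : ℝ) • φ) (LipConvex.smul_mem hφ n.cast_nonneg)
    simp only [F, Pi.smul_apply, smul_eq_mul, integral_const_mul] at h1
    nlinarith [sq_nonneg ‖J - m‖]

lemma law_mem_P_two {Ω : Type*} [MeasurableSpace Ω] {ℙ : Measure Ω} [IsProbabilityMeasure ℙ]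
    {m : Ω → Rd d} (hm : Measurable m) (hL : MemLp m 2 ℙ) : ℙ.map m ∈ P d 2 := by
  have := Measure.isProbabilityMeasure_map (μ := ℙ) hm.aemeasurable
  exact mem_P_two_of_memLp
    ((memLp_map_measure_iff continuous_id.aestronglyMeasurable hm.aemeasurable).2 hL)

lemma T2_le_of_maps {Ω : Type*} [MeasurableSpace Ω] {ℙ : Measure Ω} [IsProbabilityMeasure ℙ]
    {X Y : Ω → Rd d} (hX : Measurable X) (hY : Measurable Y) :
    T2 (ℙ.map X) (ℙ.map Y) ≤ ∫⁻ ω, ‖X ω - Y ω‖ₑ ^ 2 ∂ℙ := by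
  have hXY : Measurable fun ω => (X ω, Y ω) := hX.prodMk hY
  refine iInf₂_le_of_le (ℙ.map fun ω => (X ω, Y ω))
    ⟨Measure.isProbabilityMeasure_map hXY.aemeasurable, ?_, ?_⟩ ?_
  · rw [Measure.map_map measurable_fst hXY]; rfl
  · rw [Measure.map_map measurable_snd hXY]; rfl
  · rw [lintegral_map (by fun_prop) hXY]

lemma T2Backward_two_le_of_map (hμ : μ ∈ P d 2) (hν : ν ∈ P d 1) {m : Rd d → Rd d}
    (hm : Measurable m) (hL : MemLp m 2 μ)
    (h : ∀ φ ∈ LipConvex d, ∫ x, φ (m x) ∂μ ≤ ∫ x, φ x ∂ν) :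
    T2Backward 2 μ ν ≤ ∫⁻ x, ‖x - m x‖ₑ ^ 2 ∂μ := by
  have := hμ.1
  have hP := law_mem_P_two hm hL
  refine iInf₂_le_of_le (μ.map m) ⟨hP, convexOrder_of_lipConvex (P_two_subset_P_one hP) hν
    fun ψ hψ => ?_⟩ ?_
  · rw [integral_map hm.aemeasurable (LipConvex.continuous hψ).aestronglyMeasurable]
    exact h ψ hψ
  · simpa using T2_le_of_maps (ℙ := μ) (X := fun x => x) measurable_id hm

end BackwardProjection

/-! ### Approximate Strassen theorem for finitely many atoms -/

section FiniteStrassen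

variable {d : ℕ} {ν : Measure (Rd d)} {ι : Type*} [Fintype ι]

/-- Families of densities `f i ≥ 0` with `∑ i, p i * f i = 1`. -/
def weightedPartitions (d : ℕ) (p : ι → ℝ) : Set (ι → Rd d → ℝ) :=
  {f | (∀ i, Measurable (f i)) ∧ (∀ i y, 0 ≤ f i y) ∧ ∀ y, ∑ i, p i * f i y = 1}

/-- The barycenters and masses of a family of densities. -/
noncomputable def barycenterMass (ν : Measure (Rd d)) (f : ι → Rd d → ℝ) (i : ι) : Rd d × ℝ :=
  ∫ y, f i y • ((y, 1) : Rd d × ℝ) ∂ν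

lemma integrable_pair_one (hν : ν ∈ P d 1) : Integrable (fun y => ((y, 1) : Rd d × ℝ)) ν := by
  have := hν.1
  exact ((integrable_norm_iff continuous_id.aestronglyMeasurable).1
    (integrable_norm_of_mem_P_one hν)).prodMk (integrable_const 1)

lemma norm_le_of_mem_weightedPartitions {p : ι → ℝ} (hp : ∀ i, 0 < p i) {f : ι → Rd d → ℝ}
    (hf : f ∈ weightedPartitions d p) (i : ι) (y : Rd d) : ‖f i y‖ ≤ 1 / p i := by
  rw [Real.norm_of_nonneg (hf.2.1 i y), le_div_iff₀' (hp i), ← hf.2.2 y]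
  exact Finset.single_le_sum (f := fun i => p i * f i y)
    (fun j _ => mul_nonneg (hp j).le (hf.2.1 j y)) (Finset.mem_univ i)

lemma integrable_smul_of_mem_weightedPartitions {E : Type*} [NormedAddCommGroup E]
    [NormedSpace ℝ E] {p : ι → ℝ} (hp : ∀ i, 0 < p i) {f : ι → Rd d → ℝ}
    (hf : f ∈ weightedPartitions d p) (i : ι) {g : Rd d → E} (hg : Integrable g ν) :
    Integrable (fun y => f i y • g y) ν :=
  hg.bdd_smul (1 / p i) (hf.1 i).aestronglyMeasurable
    (.of_forall (norm_le_of_mem_weightedPartitions hp hf i))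

lemma barycenterMass_fst (hν : ν ∈ P d 1) {p : ι → ℝ} (hp : ∀ i, 0 < p i) {f : ι → Rd d → ℝ}
    (hf : f ∈ weightedPartitions d p) (i : ι) : (barycenterMass ν f i).1 = ∫ y, f i y • y ∂ν := by
  rw [barycenterMass, fst_integral
    (integrable_smul_of_mem_weightedPartitions hp hf i (integrable_pair_one hν))]
  rfl

lemma barycenterMass_snd (hν : ν ∈ P d 1) {p : ι → ℝ} (hp : ∀ i, 0 < p i) {f : ι → Rd d → ℝ}
    (hf : f ∈ weightedPartitions d p) (i : ι) : (barycenterMass ν f i).2 = ∫ y, f i y ∂ν := by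
  rw [barycenterMass, snd_integral
    (integrable_smul_of_mem_weightedPartitions hp hf i (integrable_pair_one hν))]
  simp

lemma convex_barycenterMass (hν : ν ∈ P d 1) {p : ι → ℝ} (hp : ∀ i, 0 < p i) :
    Convex ℝ (barycenterMass ν '' weightedPartitions d p) := by
  rintro _ ⟨f, hf, rfl⟩ _ ⟨g, hg, rfl⟩ a b ha hb hab
  refine ⟨fun i y => a * f i y + b * g i y, ⟨fun i => by have := hf.1 i; have := hg.1 i; fun_prop,
    fun i y => ?_, fun y => ?_⟩, ?_⟩
  · have := hf.2.1 i y
    have := hg.2.1 i y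
    positivity
  · have h1 := hf.2.2 y
    have h2 := hg.2.2 y
    calc ∑ i, p i * (a * f i y + b * g i y)
        = a * ∑ i, p i * f i y + b * ∑ i, p i * g i y := by
          rw [Finset.mul_sum, Finset.mul_sum, ← Finset.sum_add_distrib]
          exact Finset.sum_congr rfl fun i _ => by ring
      _ = 1 := by rw [h1, h2]; linarith
  · funext i
    have i1 := integrable_smul_of_mem_weightedPartitions hp hf i (integrable_pair_one hν)
    have i2 := integrable_smul_of_mem_weightedPartitions hp hg i (integrable_pair_one hν)
    simp only [barycenterMass, Pi.add_apply, Pi.smul_apply]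
    rw [← integral_smul, ← integral_smul]
    refine (integral_congr_ae (.of_forall fun y => ?_)).trans (integral_add (i1.smul a) (i2.smul b))
    simp only [add_smul, mul_smul]

lemma max_affine_mem_LipConvex [Nonempty ι] (l : ι → (Rd d × ℝ) →L[ℝ] ℝ) :
    (fun y => Finset.univ.sup' Finset.univ_nonempty fun i => l i (y, 1)) ∈ LipConvex d := by
  refine ⟨⟨convex_univ, fun x _ y _ a b ha hb hab => ?_⟩, ∑ i, ‖l i‖,
    Finset.sum_nonneg fun i _ => norm_nonneg _, fun x y => ?_⟩
  · refine Finset.sup'_le _ _ fun i _ => ?_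
    have e : ((a • x + b • y, 1) : Rd d × ℝ) = a • (x, 1) + b • (y, 1) := by
      simp [hab]
    rw [e, map_add, map_smul, map_smul]
    exact add_le_add
      (smul_le_smul_of_nonneg_left (Finset.le_sup' (fun i => l i (x, 1)) (Finset.mem_univ i)) ha)
      (smul_le_smul_of_nonneg_left (Finset.le_sup' (fun i => l i (y, 1)) (Finset.mem_univ i)) hb)
  · obtain ⟨i, -, hi⟩ := Finset.exists_mem_eq_sup' Finset.univ_nonempty fun i => l i (x, 1)
    have h1 := Finset.le_sup' (fun i => l i (y, 1)) (Finset.mem_univ i)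
    have h2 : l i (x, 1) - l i (y, 1) ≤ ‖l i‖ * ‖x - y‖ := by
      rw [← map_sub]
      refine (le_abs_self _).trans (((l i).le_opNorm _).trans_eq ?_)
      simp [Prod.norm_def]
    have h3 : ‖l i‖ ≤ ∑ i, ‖l i‖ :=
      Finset.single_le_sum (f := fun i => ‖l i‖) (fun j _ => norm_nonneg _) (Finset.mem_univ i)
    have h4 := mul_le_mul_of_nonneg_right h3 (norm_nonneg (x - y))
    simp only [hi] at *
    linarith

/-- A measurable weighted partition concentrated on the maximizers of finitely many functions. -/
lemma exists_weightedPartition_argmax [Nonempty ι] {p : ι → ℝ} (hp : ∀ i, 0 < p i)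
    {a : ι → Rd d → ℝ} (ha : ∀ i, Measurable (a i)) :
    ∃ f ∈ weightedPartitions d p, ∀ y,
      ∑ i, p i * f i y * a i y = Finset.univ.sup' Finset.univ_nonempty fun i => a i y := by
  set φ : Rd d → ℝ := fun y => Finset.univ.sup' Finset.univ_nonempty fun i => a i y
  have hφ : Measurable φ := by
    have h : φ = Finset.univ.sup' Finset.univ_nonempty a := by
      funext y
      simp [φ, Finset.sup'_apply]
    rw [h]
    exact Finset.measurable_sup' Finset.univ_nonempty fun i _ => ha i
  classical
  let e : ι → Rd d → ℝ := fun i y => if a i y = φ y then 1 else 0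
  have he : ∀ i, Measurable (e i) := fun i =>
    Measurable.ite (measurableSet_eq_fun (ha i) hφ) measurable_const measurable_const
  have he0 : ∀ i y, 0 ≤ e i y := fun i y => by simp only [e]; split_ifs <;> norm_num
  let N : Rd d → ℝ := fun y => ∑ i, e i y
  have hN : ∀ y, 0 < N y := fun y => by
    obtain ⟨i, -, hi⟩ := Finset.exists_mem_eq_sup' Finset.univ_nonempty fun i => a i y
    refine Finset.sum_pos' (fun j _ => he0 j y) ⟨i, Finset.mem_univ i, ?_⟩
    have : a i y = φ y := hi.symm
    simp [e, this]
  have hNm : Measurable N := Finset.measurable_fun_sum _ fun i _ => he i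
  -- Ties are shared equally among the N y maximizers; dividing by p i normalizes the weighted sum
  -- to 1.
  refine ⟨fun i y => e i y / (p i * N y), ⟨fun i => (he i).div (hNm.const_mul _), fun i y => ?_,
    fun y => ?_⟩, fun y => ?_⟩
  · exact div_nonneg (he0 i y) (mul_nonneg (hp i).le (hN y).le)
  · have : ∀ i, p i * (e i y / (p i * N y)) = e i y / N y := fun i => by
      have := (hp i).ne'
      have := (hN y).ne'
      field_simp
    simp only [this]
    rw [← Finset.sum_div, div_self (hN y).ne']
  · have : ∀ i, p i * (e i y / (p i * N y)) * a i y = e i y / N y * φ y := fun i => by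
      have h1 := (hp i).ne'
      have h2 := (hN y).ne'
      by_cases h : a i y = φ y
      · rw [h]; field_simp
      · simp [e, h]
    simp only [this]
    rw [← Finset.sum_mul, ← Finset.sum_div, div_self (hN y).ne', one_mul]

/-- A separating functional amounts to affine functions k i on ℝ^d. Their maximum is Lipschitz
convex, and the partition carried by the maximizers realizes its ν-integral, so separation would
contradict `h`. -/
lemma mem_closure_barycenterMass (hν : ν ∈ P d 1) {p : ι → ℝ} (hp : ∀ i, 0 < p i)
    (hsum : ∑ i, p i = 1) {m : ι → Rd d}
    (h : ∀ φ ∈ LipConvex d, ∑ i, p i * φ (m i) ≤ ∫ y, φ y ∂ν) :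
    (fun i => ((m i, 1) : Rd d × ℝ)) ∈ closure (barycenterMass ν '' weightedPartitions d p) := by
  classical
  have : Nonempty ι := by
    by_contra hne
    rw [not_nonempty_iff] at hne
    simp at hsum
  by_contra hnot
  obtain ⟨l, u, hlu, hul⟩ := geometric_hahn_banach_point_closed (convex_barycenterMass hν hp).closure
    isClosed_closure hnot
  let li : ι → (Rd d × ℝ) →L[ℝ] ℝ := fun i =>
    l.comp (ContinuousLinearMap.single ℝ (fun _ : ι => Rd d × ℝ) i)
  have hl : ∀ z : ι → Rd d × ℝ, l z = ∑ i, li i (z i) := fun z => by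
    conv_lhs => rw [← Finset.univ_sum_single z, map_sum]
    rfl
  let k : ι → (Rd d × ℝ) →L[ℝ] ℝ := fun i => (-(1 / p i)) • li i
  have hk : ∀ i z, li i z = -(p i * k i z) := fun i z => by
    have := (hp i).ne'
    simp only [k, smul_apply, smul_eq_mul]
    field_simp
  have hΛ := max_affine_mem_LipConvex k
  obtain ⟨f, hf, hfmax⟩ := exists_weightedPartition_argmax hp (a := fun i y => k i (y, 1))
    fun i => by fun_prop
  have h1 := hul _ (subset_closure ⟨f, hf, rfl⟩)
  have hi : ∀ i, Integrable (fun y => p i * f i y * k i (y, 1)) ν := fun i => by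
    have := (integrable_smul_of_mem_weightedPartitions hp hf i
      ((k i).integrable_comp (integrable_pair_one hν))).const_mul (p i)
    simpa [mul_assoc] using this
  have h2 : l (barycenterMass ν f) = -∫ y, Finset.univ.sup' Finset.univ_nonempty
      (fun i => k i (y, 1)) ∂ν := by
    rw [hl, ← integral_congr_ae (.of_forall hfmax), integral_finsetSum _ fun i _ => hi i,
      ← Finset.sum_neg_distrib]
    refine Finset.sum_congr rfl fun i _ => ?_
    rw [barycenterMass, ← ContinuousLinearMap.integral_comp_comm _
      (integrable_smul_of_mem_weightedPartitions hp hf i (integrable_pair_one hν)), ← integral_neg]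
    refine integral_congr_ae (.of_forall fun y => ?_)
    simp only [map_smul, hk, smul_eq_mul]
    ring
  have h3 := h _ hΛ
  have h4 : ∑ i, p i * k i (m i, 1) ≤ ∑ i, p i * Finset.univ.sup' Finset.univ_nonempty
      (fun j => k j (m i, 1)) := Finset.sum_le_sum fun i _ => mul_le_mul_of_nonneg_left
        (Finset.le_sup' (fun j => k j (m i, 1)) (Finset.mem_univ i)) (hp i).le
  rw [hl] at hlu
  simp only [hk, Finset.sum_neg_distrib] at hlu
  linarith

/-- Approximate Strassen theorem for a finitely supported measure `∑ p i δ_{m i}` which is dominated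
by `ν` in convex order. -/
theorem exists_densities_of_lipConvex_le (hν : ν ∈ P d 1) {p : ι → ℝ} (hp : ∀ i, 0 < p i)
    (hsum : ∑ i, p i = 1) {m : ι → Rd d}
    (h : ∀ φ ∈ LipConvex d, ∑ i, p i * φ (m i) ≤ ∫ y, φ y ∂ν) {ε : ℝ} (hε : 0 < ε) :
    ∃ f ∈ weightedPartitions d p, (∀ i, ∫ y, f i y ∂ν = 1) ∧
      ∀ i, ‖∫ y, f i y • y ∂ν - m i‖ ≤ ε := by
  have := hν.1
  have hid : Integrable (fun y : Rd d => y) ν :=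
    (integrable_norm_iff continuous_id.aestronglyMeasurable).1 (integrable_norm_of_mem_P_one hν)
  set c := ∫ y, y ∂ν
  have hM : ∀ i, ‖m i‖ ≤ ∑ i, ‖m i‖ := fun i =>
    Finset.single_le_sum (f := fun i => ‖m i‖) (fun j _ => norm_nonneg _) (Finset.mem_univ i)
  set M := ∑ i, ‖m i‖
  have hM0 : 0 ≤ M := Finset.sum_nonneg fun i _ => norm_nonneg _
  set δ := ε / (1 + M + 2 * ‖c‖)
  have hδ : 0 < δ := by positivity
  have hδε : δ * (1 + M + 2 * ‖c‖) = ε := div_mul_cancel₀ _ (by positivity)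
  obtain ⟨_, ⟨f, hf, rfl⟩, hd⟩ :=
    Metric.mem_closure_iff.1 (mem_closure_barycenterMass hν hp hsum h) δ hδ
  have hd1 : ∀ i, ‖∫ y, f i y • y ∂ν - m i‖ < δ ∧ |∫ y, f i y ∂ν - 1| < δ := fun i => by
    have h1 := (dist_le_pi_dist _ _ i).trans_lt hd
    rw [Prod.dist_eq, max_lt_iff, barycenterMass_fst hν hp hf, barycenterMass_snd hν hp hf,
      dist_comm, dist_eq_norm, dist_comm (1 : ℝ), Real.dist_eq] at h1
    exact h1
  -- The masses are only within δ of 1. Scaling by t makes them at most 1, and the constants s i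
  -- restore the deficits; since the p-weighted masses sum to 1, the partition identity survives.
  set t := 1 / (1 + δ)
  have ht0 : 0 < t := by positivity
  have htδ : t * (1 + δ) = 1 := div_mul_cancel₀ _ (by positivity)
  have hfi : ∀ i, Integrable (f i) ν := fun i => by
    simpa using integrable_smul_of_mem_weightedPartitions hp hf i (integrable_const (1 : ℝ))
  have hfyi : ∀ i, Integrable (fun y => f i y • y) ν := fun i =>
    integrable_smul_of_mem_weightedPartitions hp hf i hid
  let s : ι → ℝ := fun i => 1 - t * ∫ y, f i y ∂ν
  have hs0 : ∀ i, 0 ≤ s i := fun i => by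
    have := (abs_lt.1 (hd1 i).2).2
    simp only [s]; nlinarith
  have hs1 : ∀ i, s i ≤ 2 * δ := fun i => by
    have := (abs_lt.1 (hd1 i).2).1
    simp only [s]; nlinarith
  have hmass : ∑ i, p i * ∫ y, f i y ∂ν = 1 := by
    simp_rw [← integral_const_mul]
    rw [← integral_finsetSum _ fun i _ => (hfi i).const_mul (p i),
      integral_congr_ae (.of_forall hf.2.2)]
    simp
  refine ⟨fun i y => t * f i y + s i, ⟨fun i => ((hf.1 i).const_mul t).add_const _,
    fun i y => add_nonneg (mul_nonneg ht0.le (hf.2.1 i y)) (hs0 i), fun y => ?_⟩,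
    fun i => ?_, fun i => ?_⟩
  · calc ∑ i, p i * (t * f i y + s i)
        = t * ∑ i, p i * f i y + (∑ i, p i - t * ∑ i, p i * ∫ y, f i y ∂ν) := by
          rw [Finset.mul_sum, Finset.mul_sum, ← Finset.sum_sub_distrib, ← Finset.sum_add_distrib]
          exact Finset.sum_congr rfl fun i _ => by simp only [s]; ring
      _ = 1 := by rw [hf.2.2, hmass, hsum]; ring
  · rw [integral_add ((hfi i).const_mul t) (integrable_const _), integral_const_mul]
    simp [s]
  · have e1 : ∫ y, (t * f i y + s i) • y ∂ν = t • ∫ y, f i y • y ∂ν + s i • c := by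
      simp only [add_smul, mul_smul]
      refine (integral_add ((hfyi i).smul t) (hid.smul (s i))).trans ?_
      exact congrArg₂ _ (integral_smul t fun y => f i y • y) (integral_smul (s i) fun y => y)
    have e2 : t • ∫ y, f i y • y ∂ν + s i • c - m i
        = t • (∫ y, f i y • y ∂ν - m i) + (t - 1) • m i + s i • c := by module
    rw [e1, e2]
    refine (norm_add₃_le).trans ?_
    rw [norm_smul, norm_smul, norm_smul, Real.norm_of_nonneg ht0.le, Real.norm_of_nonneg (hs0 i),
      Real.norm_eq_abs]
    have ht1 : t ≤ 1 := by nlinarith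
    have h1 : |t - 1| ≤ δ := by
      rw [abs_le]; constructor <;> nlinarith
    have h2 : t * ‖∫ y, f i y • y ∂ν - m i‖ ≤ δ := by
      nlinarith [(hd1 i).1, norm_nonneg (∫ y, f i y • y ∂ν - m i)]
    have h3 : |t - 1| * ‖m i‖ ≤ δ * M := mul_le_mul h1 (hM i) (norm_nonneg _) hδ.le
    have h4 : s i * ‖c‖ ≤ 2 * δ * ‖c‖ := mul_le_mul_of_nonneg_right (hs1 i) (norm_nonneg _)
    linarith

end FiniteStrassen

/-! ### Shifted couplings and the forward cost -/

section ForwardProjection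

variable {d : ℕ} {μ ξ ν : Measure (Rd d)}

/-- Write x = (x - y) + y, a sum of two square integrable terms. -/
lemma mem_P_two_of_coupling {π : Measure (Rd d × Rd d)} (hν : ν ∈ P d 2)
    (hπ : π ∈ couplings ξ ν) (hc : ∫⁻ p, ‖p.1 - p.2‖ₑ ^ 2 ∂π ≠ ⊤) : ξ ∈ P d 2 := by
  have hπP := hπ.1
  have h1 : MemLp (fun p : Rd d × Rd d => p.1 - p.2) 2 π := by
    refine ⟨(continuous_fst.sub continuous_snd).aestronglyMeasurable, ?_⟩
    rw [eLpNorm_lt_top_iff_lintegral_rpow_enorm_lt_top (by simp) (by simp)]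
    simpa using hc.lt_top
  have h2 : MemLp (fun p : Rd d × Rd d => p.2) 2 π := by
    have := memLp_two_of_mem_P_two hν
    rw [← hπ.2.2] at this
    exact (memLp_map_measure_iff continuous_id.aestronglyMeasurable
      measurable_snd.aemeasurable).1 this
  rw [← hπ.2.1]
  refine law_mem_P_two measurable_fst ((h1.add h2).ae_eq (.of_forall fun p => ?_))
  simp

/-- The conditional laws averaged over the cells recover ν, which makes ν the second marginal of the
shifted coupling. -/
lemma sum_measure_prod_map_snd {ι : Type*} [Fintype ι] [IsFiniteMeasure μ] [IsFiniteMeasure ν]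
    {A : ι → Set (Rd d)}
    {f : ι → Rd d → ℝ} (hf : f ∈ weightedPartitions d fun i => μ.real (A i)) :
    ∑ i, μ (A i) • ν.withDensity (fun y => ENNReal.ofReal (f i y)) = ν := by
  ext s hs
  rw [Measure.finsetSum_apply]
  simp only [Measure.smul_apply, smul_eq_mul, withDensity_apply _ hs]
  have hm : ∀ i, Measurable fun y => ENNReal.ofReal (f i y) := fun i => (hf.1 i).ennreal_ofReal
  simp_rw [← lintegral_const_mul _ (hm _)]
  rw [← lintegral_finsetSum _ fun i _ => (hm i).const_mul _]
  have : ∀ y, ∑ i, μ (A i) * ENNReal.ofReal (f i y) = 1 := fun y => by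
    rw [← ENNReal.ofReal_one, ← hf.2.2 y, ENNReal.ofReal_sum_of_nonneg
      fun i _ => mul_nonneg measureReal_nonneg (hf.2.1 i y)]
    refine Finset.sum_congr rfl fun i _ => ?_
    rw [ENNReal.ofReal_mul measureReal_nonneg, ofReal_measureReal]
  simp [this]

/-- The cost of the forward projection, estimated by a coupling `(x, y)` with conditional laws
`f i • ν` on the cells `A i`, shifted to `(y + x - b i, y)` where `b i` is the barycenter. -/
lemma T2Forward_two_le_sum (hμ : μ ∈ P d 2) (hν : ν ∈ P d 2) {ι : Type*} [Fintype ι]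
    {A : ι → Set (Rd d)} (hA : μ = ∑ i, μ.restrict (A i)) (hpos : ∀ i, 0 < μ.real (A i))
    {f : ι → Rd d → ℝ} (hf : f ∈ weightedPartitions d fun i => μ.real (A i))
    (hmass : ∀ i, ∫ y, f i y ∂ν = 1) :
    T2Forward 2 μ ν ≤ ∑ i, ∫⁻ x in A i, ‖x - ∫ y, f i y • y ∂ν‖ₑ ^ 2 ∂μ := by
  have := hμ.1
  have := hν.1
  set b : ι → Rd d := fun i => ∫ y, f i y • y ∂ν
  have hν1 := P_two_subset_P_one hν
  have hid : Integrable (fun y : Rd d => y) ν :=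
    (integrable_norm_iff continuous_id.aestronglyMeasurable).1 (integrable_norm_of_mem_P_one hν1)
  have hm : ∀ i, Measurable fun y => ENNReal.ofReal (f i y) := fun i => (hf.1 i).ennreal_ofReal
  let κ : ι → Measure (Rd d) := fun i => ν.withDensity fun y => ENNReal.ofReal (f i y)
  have hκint : ∀ i, Integrable (fun y : Rd d => y) (κ i) ∧ ∫ y, y ∂κ i = b i := fun i => by
    have e : ∀ y : Rd d, (ENNReal.ofReal (f i y)).toReal • y = f i y • y := fun y => by
      rw [ENNReal.toReal_ofReal (hf.2.1 i y)]
    refine ⟨?_, ?_⟩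
    · rw [integrable_withDensity_iff_integrable_smul' (hm i) (.of_forall fun _ => by simp)]
      simp only [e]
      exact integrable_smul_of_mem_weightedPartitions hpos hf i hid
    · rw [integral_withDensity_eq_integral_toReal_smul (hm i) (.of_forall fun _ => by simp)]
      simp only [e, b]
  have hκ : ∀ i, IsProbabilityMeasure (κ i) := fun i => ⟨by
    have hfi : Integrable (f i) ν := by
      simpa using integrable_smul_of_mem_weightedPartitions hpos hf i (integrable_const (1 : ℝ))
    rw [withDensity_apply _ MeasurableSet.univ, Measure.restrict_univ,
      ← ofReal_integral_eq_lintegral_ofReal hfi (.of_forall (hf.2.1 i)), hmass i,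
      ENNReal.ofReal_one]⟩
  let g : ι → Rd d × Rd d → Rd d × Rd d := fun i z => (z.2 + z.1 - b i, z.2)
  have hg : ∀ i, Measurable (g i) := fun i => by fun_prop
  let Q : ι → Measure (Rd d × Rd d) := fun i => (μ.restrict (A i)).prod (κ i)
  let π : Measure (Rd d × Rd d) := ∑ i, (Q i).map (g i)
  have hsnd : π.map Prod.snd = ν := by
    simp only [π]
    rw [Measure.map_finset_sum measurable_snd.aemeasurable]
    conv_rhs => rw [← sum_measure_prod_map_snd (μ := μ) (ν := ν) hf]
    refine Finset.sum_congr rfl fun i _ => ?_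
    rw [Measure.map_map measurable_snd (hg i)]
    have : Prod.snd ∘ g i = Prod.snd := rfl
    rw [this, Measure.map_snd_prod, Measure.restrict_apply_univ]
  have hπP : IsProbabilityMeasure π := by
    have h1 : π.map Prod.snd univ = 1 := by rw [hsnd]; exact measure_univ
    rw [Measure.map_apply measurable_snd MeasurableSet.univ, preimage_univ] at h1
    exact ⟨h1⟩
  have hπ : π ∈ couplings (π.map Prod.fst) ν := ⟨hπP, rfl, hsnd⟩
  have hcost : ∫⁻ p, ‖p.1 - p.2‖ₑ ^ 2 ∂π = ∑ i, ∫⁻ x in A i, ‖x - b i‖ₑ ^ 2 ∂μ := by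
    simp only [π]
    rw [lintegral_finsetSum_measure]
    refine Finset.sum_congr rfl fun i _ => ?_
    rw [lintegral_map (by fun_prop) (hg i), lintegral_prod _ (by fun_prop)]
    refine lintegral_congr fun x => ?_
    have : ∀ y, (g i (x, y)).1 - (g i (x, y)).2 = x - b i := fun y => by
      simp only [g]; abel
    simp [this]
  by_cases htop : ∑ i, ∫⁻ x in A i, ‖x - b i‖ₑ ^ 2 ∂μ = ⊤
  · exact le_top.trans_eq htop.symm
  have hξ : π.map Prod.fst ∈ P d 2 := mem_P_two_of_coupling hν hπ (by rwa [hcost])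
  refine iInf₂_le_of_le (π.map Prod.fst) ⟨hξ, convexOrder_of_lipConvex (P_two_subset_P_one hμ)
    (P_two_subset_P_one hξ) fun φ hφ => ?_⟩ (iInf₂_le_of_le π hπ hcost.le)
  have hφc := LipConvex.continuous hφ
  have hφπ : Integrable (fun p => φ p.1) π :=
    (integrable_comp_fst hπ (LipConvex.integrable hφ (P_two_subset_P_one hξ))).1
  have hφm := LipConvex.integrable hφ (P_two_subset_P_one hμ)
  rw [integral_map measurable_fst.aemeasurable hφc.aestronglyMeasurable]
  have hφQ := integrable_finsetSum_measure.1 hφπ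
  rw [integral_finsetSum_measure hφQ]
  conv_lhs => rw [hA]
  rw [integral_finsetSum_measure fun i _ => hφm.restrict]
  refine Finset.sum_le_sum fun i hi => ?_
  have hQ : Integrable (fun z : Rd d × Rd d => φ (z.2 + z.1 - b i)) (Q i) :=
    (integrable_map_measure (hφc.comp continuous_fst).aestronglyMeasurable
      (hg i).aemeasurable).1 (hφQ i hi)
  rw [integral_map (f := fun p : Rd d × Rd d => φ p.1) (hg i).aemeasurable
    (hφc.comp continuous_fst).aestronglyMeasurable, integral_prod _ hQ]
  refine integral_mono hφm.restrict hQ.integral_prod_left fun x => ?_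
  have hyi : Integrable (fun y => y + x - b i) (κ i) :=
    ((hκint i).1.add (integrable_const x)).sub (integrable_const (b i))
  have hmean : ∫ y, (y + x - b i) ∂κ i = x := by
    simp only [add_sub_assoc]
    rw [integral_add (hκint i).1 (integrable_const (x - b i)), (hκint i).2]
    simp
  -- Jensen under κ i, where y + x - b i has mean x: this is the domination of μ.
  have hJ := hφ.1.map_integral_le (μ := κ i) hφc.continuousOn isClosed_univ (by simp) hyi
    (LipConvex.integrable_comp hφ hyi)
  rwa [hmean] at hJ

/-- A square integrable map is nearly constant on the cells of some finite partition. -/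
lemma exists_finite_partition [IsProbabilityMeasure μ] {m : Rd d → Rd d} (hL : MemLp m 2 μ)
    {ε : ℝ} (hε : 0 < ε) :
    ∃ (ι : Type) (_ : Fintype ι) (A : ι → Set (Rd d)) (c : ι → Rd d),
      (∀ i, MeasurableSet (A i)) ∧ (∀ i, 0 < μ.real (A i)) ∧ μ = ∑ i, μ.restrict (A i) ∧
      ∑ i, ∫ x in A i, ‖m x - c i‖ ^ 2 ∂μ ≤ ε := by
  classical
  obtain ⟨s, hs, hsL⟩ := hL.exists_simpleFunc_eLpNorm_sub_lt (by simp)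
    (ε := ENNReal.ofReal (Real.sqrt ε)) (by simpa using hε)
  -- Null fibres are discarded so that every cell has positive mass.
  let S := s.range.filter fun c => μ (s ⁻¹' {c}) ≠ 0
  let A : S → Set (Rd d) := fun c => s ⁻¹' {(c : Rd d)}
  have hAm : ∀ i, MeasurableSet (A i) := fun i => s.measurableSet_fiber _
  have hae : ∀ᵐ x ∂μ, x ∈ ⋃ i, A i := by
    have h1 : ∀ c ∈ s.range, ∀ᵐ x ∂μ, μ (s ⁻¹' {c}) = 0 → s x ≠ c := fun c _ => by
      by_cases hc : μ (s ⁻¹' {c}) = 0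
      · have : ∀ᵐ x ∂μ, x ∉ s ⁻¹' {c} := measure_eq_zero_iff_ae_notMem.1 hc
        filter_upwards [this] with x hx _ using hx
      · exact .of_forall fun x h => absurd h hc
    filter_upwards [(Finset.eventually_all s.range).2 h1] with x hx
    refine mem_iUnion.2 ⟨⟨s x, Finset.mem_filter.2 ⟨s.mem_range_self x, fun h =>
      hx (s x) (s.mem_range_self x) h rfl⟩⟩, rfl⟩
  have hsum : μ = ∑ i, μ.restrict (A i) := by
    rw [← Measure.sum_fintype, ← Measure.restrict_iUnion _ hAm,
      Measure.restrict_eq_self_of_ae_mem hae]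
    intro i j hij
    refine disjoint_left.2 fun x hi hj => hij (Subtype.ext ?_)
    exact (mem_singleton_iff.1 hi).symm.trans (mem_singleton_iff.1 hj)
  refine ⟨S, inferInstance, A, fun i => i, hAm, fun i => ?_, hsum, ?_⟩
  · rw [measureReal_def]
    exact ENNReal.toReal_pos (Finset.mem_filter.1 i.2).2 (measure_ne_top _ _)
  · have hi := integrable_norm_sub_sq hL hsL
    have e : ∀ i : S, ∫ x in A i, ‖m x - i‖ ^ 2 ∂μ = ∫ x in A i, ‖m x - s x‖ ^ 2 ∂μ := fun i =>
      setIntegral_congr_fun (hAm i) fun x hx => by rw [← mem_singleton_iff.1 hx]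
    simp only [e]
    rw [← integral_finsetSum_measure fun i _ => hi.restrict, ← hsum]
    rw [(hL.sub hsL).eLpNorm_eq_integral_rpow_norm (by simp) (by simp),
      ENNReal.ofReal_lt_ofReal_iff (by positivity)] at hs
    simp only [ENNReal.toReal_ofNat, Real.rpow_ofNat, Pi.sub_apply] at hs
    rw [← one_div, ← Real.sqrt_eq_rpow] at hs
    exact (Real.sqrt_lt_sqrt_iff (integral_nonneg fun x => by positivity)).1 hs |>.le

/-- The forward projection costs at most the squared distance of the identity to any map whose law
is dominated by `ν`. -/
theorem T2Forward_two_le_of_map (hμ : μ ∈ P d 2) (hν : ν ∈ P d 2) {m : Rd d → Rd d}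
    (hL : MemLp m 2 μ) (h : ∀ φ ∈ LipConvex d, ∫ x, φ (m x) ∂μ ≤ ∫ x, φ x ∂ν) {w : ℝ}
    (hw : ∫ x, ‖x - m x‖ ^ 2 ∂μ ≤ w) : T2Forward 2 μ ν ≤ ENNReal.ofReal w := by
  have := hμ.1
  have hid := memLp_two_of_mem_P_two hμ
  have hw0 : 0 ≤ w := (integral_nonneg fun x => by positivity).trans hw
  have hmi := hL.integrable one_le_two
  have key : ∀ ε : ℝ, 0 < ε → ε ≤ 1 →
      T2Forward 2 μ ν ≤ ENNReal.ofReal (w + ε * (w + 18)) := by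
    intro ε hε hε1
    -- Precision ε² is needed because these errors are later multiplied by 1 + 1/ε.
    obtain ⟨ι, _, A, c, hAm, hpos, hA, hc⟩ := exists_finite_partition hL (pow_pos hε 2)
    let p : ι → ℝ := fun i => μ.real (A i)
    let a : ι → Rd d := fun i => ⨍ x in A i, m x ∂μ
    have hne : ∀ i, μ (A i) ≠ 0 := fun i h0 => by
      have := hpos i
      simp [measureReal_def, h0] at this
    have hpsum : ∑ i, p i = 1 := by
      have h1 : μ univ = ∑ i, μ (A i) := by
        conv_lhs => rw [hA]
        simp [Measure.finsetSum_apply]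
      have h2 : μ.real univ = ∑ i, p i := by
        simp only [p, measureReal_def, h1]
        exact ENNReal.toReal_sum fun i _ => measure_ne_top _ _
      rw [← h2]; simp
    have hJ : ∀ (φ : Rd d → ℝ), ConvexOn ℝ univ φ → Continuous φ →
        Integrable (fun x => φ (m x)) μ → ∀ i, p i * φ (a i) ≤ ∫ x in A i, φ (m x) ∂μ := by
      intro φ hφ hφc hφi i
      have h1 := hφ.map_set_average_le hφc.continuousOn isClosed_univ (hne i)
        (measure_ne_top μ (A i)) (by simp) hmi.integrableOn hφi.integrableOn
      rw [setAverage_eq (f := fun x => φ (m x)), smul_eq_mul, ← div_eq_inv_mul,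
        le_div_iff₀' (hpos i)] at h1
      exact h1
    have hsumint : ∀ f : Rd d → ℝ, Integrable f μ → ∑ i, ∫ x in A i, f x ∂μ = ∫ x, f x ∂μ := by
      intro f hf
      rw [← integral_finsetSum_measure fun i _ => hf.restrict, ← hA]
    obtain ⟨f, hf, hmass, hbar⟩ := exists_densities_of_lipConvex_le (P_two_subset_P_one hν)
      (p := p) hpos hpsum (m := a) (fun φ hφ => by
        have hi := LipConvex.integrable_comp hφ hmi
        refine (Finset.sum_le_sum fun i _ => hJ φ hφ.1 (LipConvex.continuous hφ) hi i).trans ?_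
        rw [hsumint _ hi]
        exact h φ hφ) hε
    refine (T2Forward_two_le_sum hμ hν hA hpos hf hmass).trans ?_
    set b : ι → Rd d := fun i => ∫ y, f i y • y ∂ν
    -- Young's inequality splits x - b i into x - m x and a small remainder. In the factor 6, one 3
    -- comes from m - c i and the other from a i - c i, which Jensen bounds by the same integral.
    have hcell : ∀ i, ∫ x in A i, ‖x - b i‖ ^ 2 ∂μ ≤ (1 + ε) * ∫ x in A i, ‖x - m x‖ ^ 2 ∂μ
        + (1 + 1 / ε) * (6 * ∫ x in A i, ‖m x - c i‖ ^ 2 ∂μ + 3 * (p i * ε ^ 2)) := by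
      intro i
      have i1 : Integrable (fun x => ‖x - b i‖ ^ 2) μ := integrable_norm_sub_sq hid (memLp_const _)
      have i2 : Integrable (fun x => ‖x - m x‖ ^ 2) μ := integrable_norm_sub_sq hid hL
      have i3 : Integrable (fun x => ‖m x - c i‖ ^ 2) μ := integrable_norm_sub_sq hL (memLp_const _)
      have hca : p i * ‖a i - c i‖ ^ 2 ≤ ∫ x in A i, ‖m x - c i‖ ^ 2 ∂μ := by
        refine hJ (fun y => ‖y - c i‖ ^ 2) ?_ (by fun_prop) i3 i
        have h1 := (convexOn_univ_norm (E := Rd d)).pow (fun _ _ => norm_nonneg _) 2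
        have h2 := h1.translate_left (-c i)
        simpa [Function.comp_def, sub_eq_add_neg] using h2
      have hpt : ∀ x, ‖x - b i‖ ^ 2 ≤ (1 + ε) * ‖x - m x‖ ^ 2
          + (1 + 1 / ε) * (3 * ‖m x - c i‖ ^ 2 + (3 * ‖a i - c i‖ ^ 2 + 3 * ε ^ 2)) := by
        intro x
        have t1 : ‖x - b i‖ ≤ ‖x - m x‖ + (‖m x - c i‖ + ‖a i - c i‖ + ‖b i - a i‖) := by
          have e : x - b i = (x - m x) + ((m x - c i) - (a i - c i) - (b i - a i)) := by abel
          rw [e]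
          refine (norm_add_le _ _).trans (add_le_add_right ?_ _)
          exact (norm_sub_le _ _).trans (add_le_add_left (norm_sub_le _ _) _)
        have t2 := hbar i
        set r := ‖x - m x‖
        set q := ‖m x - c i‖ + ‖a i - c i‖ + ‖b i - a i‖
        have hq : q ^ 2 ≤ 3 * ‖m x - c i‖ ^ 2 + (3 * ‖a i - c i‖ ^ 2 + 3 * ε ^ 2) := by
          have t3 : ‖b i - a i‖ ^ 2 ≤ ε ^ 2 := pow_le_pow_left₀ (norm_nonneg _) t2 2
          simp only [q]
          nlinarith [sq_nonneg (‖m x - c i‖ - ‖a i - c i‖), sq_nonneg (‖m x - c i‖ - ‖b i - a i‖),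
            sq_nonneg (‖a i - c i‖ - ‖b i - a i‖)]
        have hrq : (r + q) ^ 2 ≤ (1 + ε) * r ^ 2 + (1 + 1 / ε) * q ^ 2 := by
          have : (1 + ε) * r ^ 2 + (1 + 1 / ε) * q ^ 2 - (r + q) ^ 2 = (ε * r - q) ^ 2 / ε := by
            field_simp; ring
          have : 0 ≤ (ε * r - q) ^ 2 / ε := by positivity
          linarith
        have h5 : 0 ≤ 1 + 1 / ε := by positivity
        have := mul_le_mul_of_nonneg_left hq h5
        have := pow_le_pow_left₀ (norm_nonneg _) t1 2
        linarith
      have j3 : Integrable (fun x => 3 * ‖m x - c i‖ ^ 2 + (3 * ‖a i - c i‖ ^ 2 + 3 * ε ^ 2))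
        (μ.restrict (A i)) := (i3.restrict.const_mul 3).add (integrable_const _)
      have hmono := integral_mono i1.restrict ((i2.restrict.const_mul (1 + ε)).add
        (j3.const_mul (1 + 1 / ε))) hpt
      simp only [Pi.add_apply] at hmono
      rw [integral_add (i2.restrict.const_mul (1 + ε)) (j3.const_mul (1 + 1 / ε)),
        integral_const_mul, integral_const_mul,
        integral_add (i3.restrict.const_mul 3) (integrable_const _), integral_const_mul,
        setIntegral_const, smul_eq_mul] at hmono
      refine hmono.trans (add_le_add_right (mul_le_mul_of_nonneg_left ?_ (by positivity)) _)
      simp only [p] at hca ⊢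
      linarith
    have htotal : ∑ i, ∫ x in A i, ‖x - b i‖ ^ 2 ∂μ ≤ w + ε * (w + 18) := by
      refine (Finset.sum_le_sum fun i _ => hcell i).trans ?_
      rw [Finset.sum_add_distrib, ← Finset.mul_sum, ← Finset.mul_sum, Finset.sum_add_distrib,
        ← Finset.mul_sum, ← Finset.mul_sum, ← Finset.sum_mul, hpsum,
        hsumint _ (integrable_norm_sub_sq hid hL)]
      have h1 : (1 + 1 / ε) * (6 * ∑ i, ∫ x in A i, ‖m x - c i‖ ^ 2 ∂μ + 3 * (1 * ε ^ 2))
          ≤ (1 + 1 / ε) * (9 * ε ^ 2) :=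
        mul_le_mul_of_nonneg_left (by linarith) (by positivity)
      -- For ε ≤ 1 this is at most 18 ε, whence the constant in `key`.
      have h2 : (1 + 1 / ε) * (9 * ε ^ 2) = 9 * ε ^ 2 + 9 * ε := by field_simp
      have h3 := mul_le_mul_of_nonneg_left hw (by linarith : (0 : ℝ) ≤ 1 + ε)
      nlinarith
    refine le_trans (le_of_eq ?_) (ENNReal.ofReal_le_ofReal htotal)
    rw [ENNReal.ofReal_sum_of_nonneg fun i _ => integral_nonneg fun x => by positivity]
    refine Finset.sum_congr rfl fun i _ => ?_
    have i1 : Integrable (fun x => ‖x - b i‖ ^ 2) μ := integrable_norm_sub_sq hid (memLp_const _)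
    rw [ofReal_integral_eq_lintegral_ofReal i1.restrict (.of_forall fun x => by positivity)]
    refine lintegral_congr fun x => ?_
    rw [ENNReal.ofReal_pow (norm_nonneg _), ofReal_norm]
  have hlim : Tendsto (fun ε : ℝ => ENNReal.ofReal (w + ε * (w + 18))) (𝓝[>] 0)
      (𝓝 (ENNReal.ofReal (w + 0 * (w + 18)))) :=
    (ENNReal.continuous_ofReal.tendsto _).comp (tendsto_nhdsWithin_of_tendsto_nhds
      (by fun_prop : Continuous fun ε : ℝ => w + ε * (w + 18)).continuousAt)
  rw [zero_mul, add_zero] at hlim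
  refine ge_of_tendsto hlim ?_
  filter_upwards [Ioc_mem_nhdsGT (zero_lt_one' ℝ)] with ε hε using key ε hε.1 hε.2

end ForwardProjection

/-! ### Closing the inequalities -/

section Duality

variable {d : ℕ} {μ ν : Measure (Rd d)}

lemma hasExtInt_of_mem_L1 {f : Rd d → EReal} (hf : f ∈ L1 μ) : HasExtInt f μ :=
  ⟨hf.1, .inl hf.2.1⟩

/-- Both projection costs are bounded by the dual problem over Lipschitz convex functions. -/
theorem T2_projections_le_iSup_lipConvex (hμ : μ ∈ P d 2) (hν : ν ∈ P d 2) :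
    (T2Backward 2 μ ν : EReal) ≤ ⨆ φ ∈ LipConvex d, backwardDual μ ν (fun x => (φ x : EReal)) ∧
    (T2Forward 2 μ ν : EReal) ≤ ⨆ φ ∈ LipConvex d, backwardDual μ ν (fun x => (φ x : EReal)) := by
  have hν1 := P_two_subset_P_one hν
  have hle : ∀ φ ∈ LipConvex d, backwardDual μ ν (fun x => (φ x : EReal)) ≤
      ⨆ φ ∈ LipConvex d, backwardDual μ ν (fun x => (φ x : EReal)) := fun φ hφ =>
    le_iSup₂ (f := fun (φ : Rd d → ℝ) (_ : φ ∈ LipConvex d) =>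
      backwardDual μ ν (fun x => (φ x : EReal))) φ hφ
  generalize (⨆ φ ∈ LipConvex d, backwardDual μ ν (fun x => (φ x : EReal))) = S at *
  induction S with
  | bot =>
    -- The potential 0 has a finite dual value, so the supremum is not -∞.
    have h := hle 0 LipConvex.zero_mem
    rw [backwardDual, extInt_of_mem_L1 (Q2_mem_L1 (coe_mem_Acx LipConvex.zero_mem.1) hμ),
      extInt_coe (LipConvex.integrable LipConvex.zero_mem hν1), ← EReal.coe_sub] at h
    exact absurd (le_bot_iff.1 h) (EReal.coe_ne_bot _)
  | top => exact ⟨le_top, le_top⟩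
  | coe w =>
    obtain ⟨m, hm, hL, hmw, hmν⟩ := exists_map_of_backwardDual_le hμ hν1 hle
    have hw0 : 0 ≤ w := (integral_nonneg fun x => by positivity).trans hmw
    have hcoe : ((ENNReal.ofReal w : ℝ≥0∞) : EReal) = w := by
      rw [EReal.coe_ennreal_ofReal, max_eq_left hw0]
    rw [← hcoe, EReal.coe_ennreal_le_coe_ennreal_iff, EReal.coe_ennreal_le_coe_ennreal_iff]
    refine ⟨(T2Backward_two_le_of_map hμ hν1 hm hL hmν).trans ?_,
      T2Forward_two_le_of_map hμ hν hL hmν hmw⟩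
    refine le_trans (le_of_eq ?_) (ENNReal.ofReal_le_ofReal hmw)
    rw [ofReal_integral_eq_lintegral_ofReal
      (integrable_norm_sub_sq (memLp_two_of_mem_P_two hμ) hL) (.of_forall fun x => by positivity)]
    refine lintegral_congr fun x => ?_
    rw [ENNReal.ofReal_pow (norm_nonneg _), ofReal_norm]

lemma LipConvex.coe_mem (φ : Rd d → ℝ) (hφ : φ ∈ LipConvex d) :
    (fun x => (φ x : EReal)) ∈ Acx d ∩ Cb d 1 :=
  ⟨coe_mem_Acx hφ.1, LipConvex.coe_mem_Cb_one hφ⟩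

/-- The potential `Q2 φ` is at least as good for the forward problem as `φ` for the backward
problem. -/
lemma backwardDual_le_forwardDual_Q2 (hν : ν ∈ P d 1) {φ : Rd d → ℝ} (hφ : φ ∈ LipConvex d) :
    backwardDual μ ν (fun x => (φ x : EReal)) ≤
      forwardDual μ ν (Q2 fun x => (φ x : EReal)) := by
  obtain ⟨q, hq, hqe⟩ := LipConvex.exists_Q2_eq hφ
  have hle : ∀ y, Q2bar (Q2 fun x => (φ x : EReal)) y ≤ φ y := fun y =>
    iSup_le fun x => EReal.sub_le_of_le_add (iInf_le _ y)
  refine EReal.sub_le_sub le_rfl ?_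
  rw [extInt_le_extInt_iff]
  · exact add_le_add (posInt_mono (.of_forall hle)) (negInt_anti (.of_forall hle))
  · rw [hqe]; exact negInt_Q2bar_ne_top (coe_mem_Acx hq.1) hν
  · exact Acx.negInt_ne_top (coe_mem_Acx hφ.1) hν

lemma iSup_backwardDual_lipConvex_le :
    ⨆ φ ∈ LipConvex d, backwardDual μ ν (fun x => (φ x : EReal)) ≤
      ⨆ φ ∈ Acx d ∩ Cb d 1, backwardDual μ ν φ :=
  iSup₂_le fun φ hφ => le_iSup₂ (f := fun φ (_ : φ ∈ Acx d ∩ Cb d 1) => backwardDual μ ν φ) _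
    (LipConvex.coe_mem φ hφ)

lemma iSup_backwardDual_lipConvex_le_forward (hν : ν ∈ P d 1) :
    ⨆ φ ∈ LipConvex d, backwardDual μ ν (fun x => (φ x : EReal)) ≤
      ⨆ φ ∈ Acx d ∩ Cb d 1, forwardDual μ ν φ := by
  refine iSup₂_le fun φ hφ => (backwardDual_le_forwardDual_Q2 hν hφ).trans ?_
  obtain ⟨q, hq, hqe⟩ := LipConvex.exists_Q2_eq hφ
  rw [hqe]
  exact le_iSup₂ (f := fun φ (_ : φ ∈ Acx d ∩ Cb d 1) => forwardDual μ ν φ) _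
    (LipConvex.coe_mem q hq)

lemma T2Backward_one_le_two : T2Backward 1 μ ν ≤ T2Backward 2 μ ν :=
  biInf_mono fun _ h => ⟨P_two_subset_P_one h.1, h.2⟩

lemma T2Forward_one_le_two : T2Forward 1 μ ν ≤ T2Forward 2 μ ν :=
  biInf_mono fun _ h => ⟨P_two_subset_P_one h.1, h.2⟩

end Duality

theorem mainTheorem9 (d : ℕ) (μ ν : Measure (Rd d)) (hμ : μ ∈ P d 2) (hν : ν ∈ P d 2) :
    -- (i) backward projection
    ((∀ φ ∈ Acx d ∩ L1 ν, HasExtInt (Q2 φ) μ) ∧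
      T2Backward 1 μ ν = T2Backward 2 μ ν ∧
      ∀ k : ℕ, k = 1 ∨ k = 2 →
        Acx d ∩ Sb d k ⊆ L1 ν ∧
        (T2Backward k μ ν : EReal) = ⨆ φ ∈ Acx d ∩ Cb d k, backwardDual μ ν φ ∧
        (T2Backward k μ ν : EReal) = ⨆ φ ∈ Acx d ∩ Sb d k, backwardDual μ ν φ ∧
        (T2Backward k μ ν : EReal) = ⨆ φ ∈ Acx d ∩ L1 ν, backwardDual μ ν φ) ∧
    -- (ii) forward projection
    (T2Forward 1 μ ν = T2Forward 2 μ ν ∧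
      ∀ k : ℕ, k = 1 ∨ k = 2 →
        (∀ φ ∈ Acx d ∩ Sb d k, φ ∈ L1 μ ∧ HasExtInt (Q2bar φ) ν) ∧
        (T2Forward k μ ν : EReal) = ⨆ φ ∈ Acx d ∩ Cb d k, forwardDual μ ν φ ∧
        (T2Forward k μ ν : EReal) = ⨆ φ ∈ Acx d ∩ Sb d k, forwardDual μ ν φ) := by
  have hν1 := P_two_subset_P_one hν
  obtain ⟨hB, hF⟩ := T2_projections_le_iSup_lipConvex hμ hν
  have hSL : ∀ {k : ℕ}, k = 1 ∨ k = 2 → Acx d ∩ Sb d k ⊆ Acx d ∩ L1 ν := fun hk =>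
    inter_subset_inter_right _ ((Sb_subset_Sb_two hk).trans (Sb_two_subset_L1 hν))
  have hCS : ∀ (k : ℕ), Acx d ∩ Cb d k ⊆ Acx d ∩ Sb d k := fun _ =>
    inter_subset_inter_right _ Cb_subset_Sb
  have hCC : ∀ {k : ℕ}, k = 1 ∨ k = 2 → Acx d ∩ Cb d 1 ⊆ Acx d ∩ Cb d k := fun hk =>
    inter_subset_inter_right _ (Cb_one_subset_Cb hk)
  -- The cost for k = 2 is at most S, hence at most the dual supremum over the smallest class, which
  -- weak duality bounds by the cost for k = 1.
  have hBeq : T2Backward 1 μ ν = T2Backward 2 μ ν := by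
    refine le_antisymm T2Backward_one_le_two (EReal.coe_ennreal_le_coe_ennreal_iff.1 ?_)
    refine hB.trans (iSup_backwardDual_lipConvex_le.trans (iSup₂_le fun φ hφ => ?_))
    have hφ' := hSL (.inl rfl) (hCS _ hφ)
    exact backwardDual_le_T2Backward (.inl rfl) hμ hν1 hφ'.1 hφ'.2
  have hFeq : T2Forward 1 μ ν = T2Forward 2 μ ν := by
    refine le_antisymm T2Forward_one_le_two (EReal.coe_ennreal_le_coe_ennreal_iff.1 ?_)
    refine hF.trans ((iSup_backwardDual_lipConvex_le_forward hν1).trans (iSup₂_le fun φ hφ => ?_))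
    exact forwardDual_le_T2Forward (.inl rfl) hμ hν hφ.1
      (Sb_subset_Sb_two (.inl rfl) (Cb_subset_Sb hφ.2))
  refine ⟨⟨fun φ hφ => hasExtInt_of_mem_L1 (Q2_mem_L1 hφ.1 hμ), hBeq, fun k hk => ?_⟩,
    hFeq, fun k hk => ?_⟩
  · have h1 : (T2Backward k μ ν : EReal) ≤ ⨆ φ ∈ Acx d ∩ Cb d k, backwardDual μ ν φ := by
      have : T2Backward k μ ν = T2Backward 2 μ ν := by
        rcases hk with rfl | rfl
        exacts [hBeq, rfl]
      rw [this]
      exact (hB.trans iSup_backwardDual_lipConvex_le).trans (biSup_mono fun φ hφ => hCC hk hφ)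
    have h2 : ⨆ φ ∈ Acx d ∩ Cb d k, backwardDual μ ν φ ≤
        ⨆ φ ∈ Acx d ∩ Sb d k, backwardDual μ ν φ := biSup_mono fun φ hφ => hCS _ hφ
    have h3 : ⨆ φ ∈ Acx d ∩ Sb d k, backwardDual μ ν φ ≤
        ⨆ φ ∈ Acx d ∩ L1 ν, backwardDual μ ν φ := biSup_mono fun φ hφ => hSL hk hφ
    have h4 : ⨆ φ ∈ Acx d ∩ L1 ν, backwardDual μ ν φ ≤ (T2Backward k μ ν : EReal) :=
      iSup₂_le fun φ hφ => backwardDual_le_T2Backward hk hμ hν1 hφ.1 hφ.2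
    exact ⟨fun φ hφ => (hSL hk hφ).2, le_antisymm h1 (h2.trans (h3.trans h4)),
      le_antisymm (h1.trans h2) (h3.trans h4), le_antisymm (h1.trans (h2.trans h3)) h4⟩
  · have h1 : (T2Forward k μ ν : EReal) ≤ ⨆ φ ∈ Acx d ∩ Cb d k, forwardDual μ ν φ := by
      have : T2Forward k μ ν = T2Forward 2 μ ν := by
        rcases hk with rfl | rfl
        exacts [hFeq, rfl]
      rw [this]
      exact (hF.trans (iSup_backwardDual_lipConvex_le_forward hν1)).trans
        (biSup_mono fun φ hφ => hCC hk hφ)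
    have h2 : ⨆ φ ∈ Acx d ∩ Cb d k, forwardDual μ ν φ ≤
        ⨆ φ ∈ Acx d ∩ Sb d k, forwardDual μ ν φ := biSup_mono fun φ hφ => hCS _ hφ
    have h3 : ⨆ φ ∈ Acx d ∩ Sb d k, forwardDual μ ν φ ≤ (T2Forward k μ ν : EReal) :=
      iSup₂_le fun φ hφ => forwardDual_le_T2Forward hk hμ hν hφ.1 (Sb_subset_Sb_two hk hφ.2)
    refine ⟨fun φ hφ => ⟨Sb_two_subset_L1 hμ (Sb_subset_Sb_two hk hφ.2), ?_,
      .inr (negInt_Q2bar_ne_top hφ.1 hν1)⟩, le_antisymm h1 (h2.trans h3),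
      le_antisymm (h1.trans h2) h3⟩
    obtain ⟨u, -, -, rfl⟩ := hφ.2
    exact measurable_Q2bar.aemeasurable
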